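/- **Setting.** Let $B\ge 1$, $N_1,\dots,N_B\ge 1$ be integers, $\bm s=(s_1,\dots,s_B)$ with $s_k>0$, let $\bm{\mathcal C}=(\mathcal C_1,\dots,\mathcal C_J)$ be a partition of $\{1,\dots,B\}$ and $\bm\zeta\in\mathbb R_+^J$; all are fixed. For a symmetric positive definite $d\times d$ matrix $\Sigma$ with $\operatorname{Tr}\Sigma=1$, put $d^{\mathrm e}(\Sigma)=\operatorname{Tr}\Sigma/\|\Sigma\|_{\infty}$ ($\|\cdot\|_\infty$ the operator norm), and let $\mathcal P_{\mathrm{mult}}(\bm{\mathcal C},\bm\zeta,\Sigma,\bm s)$ be the set of joint distributions $\mathbb Q$ of independent samples $X^{(k)}_i$, $1\le k\le B$, $1\le i\le N_k$, with $X^{(k)}_i\sim\mathcal N(\mu_k,\,N_k s_k^2\Sigma)$, whose means $\bm\mu=(\mu_k)\in(\mathbb R^d)^B$ are arbitrary subject to $\operatorname{diam}(\bm{\mathcal C},\bm\mu)_j:=\max_{k,\ell\in\mathcal C_j}\|\mu_k-\mu_\ell\|\le\zeta_j$ for all $j$. For a joint estimator $\widehat{\bm\mu}=(\widehat\mu_1,\dots,\widehat\mu_B)$,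 i.e. a measurable function of all the samples, let $R_k(\mathbb Q,\widehat\mu_k)=\mathbb E_{\mathbb Q}\|\widehat\mu_k-\mu_k\|^2$, and for $t\geq 1$ put $$M(t):=\sup_{\Sigma:\ d^{\mathrm e}(\Sigma)=t}\ \inf_{\widehat{\bm\mu}}\ \sup_{\mathbb Q\in\mathcal P_{\mathrm{mult}}(\bm{\mathcal C},\bm\zeta,\Sigma,\bm s)}\ \frac1B\sum_{k=1}^B\frac{R_k(\mathbb Q,\widehat\mu_k)}{s_k^2},$$ where $\Sigma$ ranges over the matrices as above of any size $d$. Let $$\mathcal B(\tau,\nu)=\frac{\tau}{1+\tau}+\frac1{1+\tau}\cdot\frac{\nu}{1+\tau(1-\nu)},\quad \mathcal L^*(\bm s,\bm{\mathcal C},\bm\zeta)=\frac1B\sum_{j=1}^J\sum_{k\in\mathcal C_j}\mathcal B\Big(\frac{\zeta_j^2}{s_k^2},\frac{s^2(\mathcal C_j)}{s_k^2}\Big),\quad s^2(U)=\Big(\sum_{k\in U}s_k^{-2}\Big)^{-1}.$$ **Theorem (compound minimax lower bound).** $$\liminf_{t\to\infty} M(t)\ \ge\ \mathcal L^*(\bm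 s,\bm{\mathcal C},\bm\zeta/2)\ \ge\ \tfrac14\,\mathcal L^*(\bm s,\bm{\mathcal C},\bm\zeta).$$ **Consequence (the $Q$-aggregation bound matches up to a constant factor).** For $c\ge 0$, $u\ge\log(17B)$, put $d^{\mathrm e}_k=d^{\mathrm e}(N_ks_k^2\Sigma)$ and let $$U_{c,u}(\Sigma,\bm\mu)=\big(1+cBe^{-u/2}\big)\min_{\bm{\mathcal C}'}\Big(\mathcal L^*\big(\bm s,\bm{\mathcal C}',\operatorname{diam}(\bm{\mathcal C}',\bm\mu)\big)+\frac{c\,u}{\min_k (d^{\mathrm e}_k)^{1/2}}\Big),$$ with the minimum over all partitions $\bm{\mathcal C}'$ of $\{1,\dots,B\}$; this is the upper bound on the compound relative risk of the $Q$-aggregation estimator with calibration parameter $u$ and absolute constant $c$. Then $$\limsup_{t\to\infty}\ \sup_{\Sigma:\,d^{\mathrm e}(\Sigma)=t}\ \sup_{\bm\mu:\,\operatorname{diam}(\bm{\mathcal C},\bm\mu)\le\bm\zeta}U_{c,u}(\Sigma,\bm\mu)\ \le\ 4\big(1+cBe^{-u/2}\big)\,\liminf_{t\to\infty}M(t),$$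 and, if $u\ge 2\log(17B)$, the same inequality holds with the factor $4(1+c/17)$, which depends on $c$ only. -/

import Mathlib

open MeasureTheory ProbabilityTheory Filter
open scoped ENNReal

namespace CompoundMinimax

noncomputable section

/-- Effective dimension `Tr S / ‖S‖` of a matrix `S`, where `‖S‖` is its operator norm on the
Euclidean space `ℝ^d`. -/
def effDim {d : ℕ} (S : Matrix (Fin d) (Fin d) ℝ) : ℝ :=
  S.trace / ‖Matrix.toEuclideanCLM (𝕜 := ℝ) S‖

/-- `C = (C_1, …, C_J)` is a partition of the set of tasks `Fin B`, indexed by `Fin J`. -/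
def IsPartition {B J : ℕ} (C : Fin J → Finset (Fin B)) : Prop :=
  ∀ k, ∃! j, k ∈ C j

/-- The diameter of group `j` for the means `μ`: the largest distance `‖μ_k - μ_l‖`
for `k, l ∈ C_j`. -/
def groupDiam {B J d : ℕ} (C : Fin J → Finset (Fin B))
    (μ : Fin B → EuclideanSpace ℝ (Fin d)) (j : Fin J) : ℝ :=
  Metric.diam (μ '' (C j : Set (Fin B)))

/-- The oracle relative risk function. -/
def oracleRisk (τ ν : ℝ) : ℝ :=
  τ / (1 + τ) + 1 / (1 + τ) * (ν / (1 + τ * (1 - ν)))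

/-- The aggregated variance `s²(U) = (∑_{k ∈ U} s_k⁻²)⁻¹`. -/
def aggVar {B : ℕ} (s : Fin B → ℝ) (U : Finset (Fin B)) : ℝ :=
  (∑ k ∈ U, 1 / s k ^ 2)⁻¹

/-- The compound oracle relative risk `L*(s, C, ζ)`. -/
def Lstar {B J : ℕ} (s : Fin B → ℝ) (C : Fin J → Finset (Fin B)) (ζ : Fin J → ℝ) : ℝ :=
  1 / (B : ℝ) *
    ∑ j, ∑ k ∈ C j, oracleRisk (ζ j ^ 2 / s k ^ 2) (aggVar s (C j) / s k ^ 2)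

/-- The space of observations: for each task `k`, a bag of `N k` vectors of `ℝ^d`. -/
abbrev Sample {B : ℕ} (N : Fin B → ℕ) (d : ℕ) : Type :=
  (k : Fin B) → Fin (N k) → EuclideanSpace ℝ (Fin d)

/-- The aligned covariance matrices `Σ_k = N_k s_k² Σ`. -/
def taskCov {B d : ℕ} (N : Fin B → ℕ) (s : Fin B → ℝ) (S : Matrix (Fin d) (Fin d) ℝ)
    (k : Fin B) : Matrix (Fin d) (Fin d) ℝ :=
  ((N k : ℝ) * s k ^ 2) • S

/-- The joint law of the bags: all observations are independent, and those of the `k`-th bag are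
distributed as `𝒩(μ_k, Σ_k)` with `Σ_k = N_k s_k² Σ`. -/
def jointLaw {B d : ℕ} (N : Fin B → ℕ) (s : Fin B → ℝ) (S : Matrix (Fin d) (Fin d) ℝ)
    (μ : Fin B → EuclideanSpace ℝ (Fin d)) : Measure (Sample N d) :=
  Measure.pi fun k => Measure.pi fun _ : Fin (N k) => multivariateGaussian (μ k) (taskCov N s S k)

/-- The means allowed in the model: group diameters bounded by `ζ`, coordinatewise. -/
def meanClass {B J : ℕ} (d : ℕ) (C : Fin J → Finset (Fin B)) (ζ : Fin J → ℝ) :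
    Set (Fin B → EuclideanSpace ℝ (Fin d)) :=
  {μ | ∀ j, groupDiam C μ j ≤ ζ j}

/-- The risk `R_k = E ‖T_k - μ_k‖²` of the joint estimator `T` for the mean of task `k`. -/
def risk {B d : ℕ} (N : Fin B → ℕ) (s : Fin B → ℝ) (S : Matrix (Fin d) (Fin d) ℝ)
    (μ : Fin B → EuclideanSpace ℝ (Fin d))
    (T : Sample N d → Fin B → EuclideanSpace ℝ (Fin d)) (k : Fin B) : ℝ≥0∞ :=
  ∫⁻ x, ENNReal.ofReal (‖T x k - μ k‖ ^ 2) ∂(jointLaw N s S μ)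

/-- The compound relative risk `B⁻¹ ∑_k R_k / s_k²`. -/
def compoundRisk {B d : ℕ} (N : Fin B → ℕ) (s : Fin B → ℝ) (S : Matrix (Fin d) (Fin d) ℝ)
    (μ : Fin B → EuclideanSpace ℝ (Fin d))
    (T : Sample N d → Fin B → EuclideanSpace ℝ (Fin d)) : ℝ≥0∞ :=
  (∑ k, risk N s S μ T k / ENNReal.ofReal (s k ^ 2)) / (B : ℝ≥0∞)

/-- The minimax compound relative risk: infimum over all joint estimators (measurable functions of
the observations), supremum over the distributions of the model. -/
def minimaxRisk {B J d : ℕ} (N : Fin B → ℕ) (s : Fin B → ℝ) (C : Fin J → Finset (Fin B))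
    (ζ : Fin J → ℝ) (S : Matrix (Fin d) (Fin d) ℝ) : ℝ≥0∞ :=
  ⨅ (T : Sample N d → Fin B → EuclideanSpace ℝ (Fin d)) (_ : Measurable T),
    ⨆ μ ∈ meanClass d C ζ, compoundRisk N s S μ T

/-- The shape matrices of effective dimension `t` and size `d`: symmetric positive definite
with unit trace. -/
def shapeMatrices (d : ℕ) (t : ℝ) : Set (Matrix (Fin d) (Fin d) ℝ) :=
  {S | S.PosDef ∧ S.trace = 1 ∧ effDim S = t}

/-- The largest minimax compound relative risk over all shape matrices, of any size, of effective
dimension `t`. -/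
def worstMinimaxRisk {B J : ℕ} (N : Fin B → ℕ) (s : Fin B → ℝ) (C : Fin J → Finset (Fin B))
    (ζ : Fin J → ℝ) (t : ℝ) : ℝ≥0∞ :=
  ⨆ (d : ℕ) (S ∈ shapeMatrices d t), minimaxRisk N s C ζ S

/-- The compound risk bound of `Q`-aggregation with calibration parameter `u` and absolute
constant `c`,
`(1 + c B e^{-u/2}) min_C (L*(s, C, diam(C, μ)) + c u / min_k (d^e_k)^{1/2})`,
with the minimum over all partitions of the tasks. -/
def qAggBound {B d : ℕ} (c u : ℝ) (N : Fin B → ℕ) (s : Fin B → ℝ)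
    (S : Matrix (Fin d) (Fin d) ℝ) (μ : Fin B → EuclideanSpace ℝ (Fin d)) : ℝ :=
  (1 + c * B * Real.exp (-u / 2)) *
    ⨅ P : {C : Fin B → Finset (Fin B) // IsPartition C},
      (Lstar s P.1 (groupDiam P.1 μ) + c * u / ⨅ k, √(effDim (taskCov N s S k)))

/-- The largest `Q`-aggregation bound over all distributions of the model of effective
dimension `t`. -/
def worstQAggBound {B J : ℕ} (c u : ℝ) (N : Fin B → ℕ) (s : Fin B → ℝ)
    (C : Fin J → Finset (Fin B)) (ζ : Fin J → ℝ) (t : ℝ) : ℝ≥0∞ :=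
  ⨆ (d : ℕ) (S ∈ shapeMatrices d t) (μ ∈ meanClass d C ζ),
    ENNReal.ofReal (qAggBound c u N s S μ)

end

end CompoundMinimax

/-! The lower bound is a Bayes argument. On the means put the prior `μ_k = σ g_{c(k)} + r_{c(k)}
g_k`, where `c(k)` is the group of `k`, the `g`'s are independent `𝒩(0, Σ)`, `σ² = 1/h` and `r_j =
(1-h) ζ_j/2`. Means and observations are then linear combinations of one white noise, so the Bayes
problem reduces to an orthogonal projection of coefficient vectors: the residual of `μ_k` is
independent of the data, and its second moment bounds the risk of every estimator from below
(`le_lintegral_bayes`). The projection is explicit (`normal_equations`), and since `Tr Σ = 1` the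
resulting relative risk `bayesRisk` does not depend on the dimension.

The prior is not supported in the model, but nearly so in high effective dimension: `‖g_k‖²` has
mean 1 and variance `O(1/t)` (`lintegral_sq_norm_sub_one`), so with high probability every
individual shift is at most `ζ_j/2`. The shared term, however large, does not affect group
diameters. An estimator might still lose a great deal on the bad event; clipping it around one
observation makes that loss harmless, and the Bayes risk is at most the loss on the good event plus
`O(1/t)` (`bayesRisk_le_lintegral_goodSet`). On the good event the average risk is at most the
supremum over the model (`lintegral_goodLoss_le_iSup`).

Letting `t → ∞` and then `h → 0` (flat prior on the centres, `r_j → ζ_j/2`) gives a limiting Bayes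
risk that dominates the oracle risk at `ζ/2` (`oracleRisk_le_bayesRisk`). Halving `ζ` divides the
oracle risk by at most 4 (`oracleRisk_div_four_le`). For the consequence, the partition of the model
is a candidate in the minimum defining the `Q`-aggregation bound, and its remainder is of order
`t^{-1/2}`. -/

namespace CompoundMinimax

noncomputable section

/-! ### Linear combinations of Gaussian white noise and the Bayes lower bound. -/

section WhiteNoise

variable {ι α : Type*} [Fintype ι] [Fintype α] {d : ℕ}

/-- The law of a family of independent centred Gaussian vectors with covariance `S`. -/
def whiteNoise (ι : Type*) [Fintype ι] {d : ℕ} (S : Matrix (Fin d) (Fin d) ℝ) :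
    Measure (ι → EuclideanSpace ℝ (Fin d)) :=
  Measure.pi fun _ => multivariateGaussian 0 S

instance (S : Matrix (Fin d) (Fin d) ℝ) : IsProbabilityMeasure (whiteNoise ι S) := by
  unfold whiteNoise; infer_instance

/-- The linear combination of a family of vectors with given coefficients. -/
def lin (c : ι → ℝ) (ω : ι → EuclideanSpace ℝ (Fin d)) : EuclideanSpace ℝ (Fin d) :=
  ∑ i, c i • ω i

@[fun_prop]
lemma measurable_lin (c : ι → ℝ) :
    Measurable (lin c : (ι → EuclideanSpace ℝ (Fin d)) → EuclideanSpace ℝ (Fin d)) := by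
  unfold lin; fun_prop

lemma lin_add (c c' : ι → ℝ) (ω : ι → EuclideanSpace ℝ (Fin d)) :
    lin (c + c') ω = lin c ω + lin c' ω := by
  simp [lin, add_smul, Finset.sum_add_distrib]

lemma lin_smul (a : ℝ) (c : ι → ℝ) (ω : ι → EuclideanSpace ℝ (Fin d)) :
    lin (a • c) ω = a • lin c ω := by
  simp [lin, mul_smul, Finset.smul_sum]

lemma lin_sum (c : α → ι → ℝ) (ω : ι → EuclideanSpace ℝ (Fin d)) :
    lin (∑ a, c a) ω = ∑ a, lin (c a) ω := by
  simp only [lin, Finset.sum_apply, Finset.sum_smul]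
  exact Finset.sum_comm

lemma hasGaussianLaw_whiteNoise (S : Matrix (Fin d) (Fin d) ℝ) :
    HasGaussianLaw (fun ω : ι → EuclideanSpace ℝ (Fin d) => (fun i => ω i)) (whiteNoise ι S) := by
  refine iIndepFun.hasGaussianLaw (X := fun i (ω : ι → EuclideanSpace ℝ (Fin d)) => ω i)
    (fun i => ?_) ?_
  · refine HasLaw.hasGaussianLaw (μ := multivariateGaussian 0 S) ⟨(measurable_pi_apply i).aemeasurable, ?_⟩
    exact (measurePreserving_eval (fun _ : ι => multivariateGaussian 0 S) i).map_eq
  · exact iIndepFun_pi (X := fun _ x => x) (fun _ => by fun_prop)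

lemma memLp_dual_eval (S : Matrix (Fin d) (Fin d) ℝ) (A : StrongDual ℝ (EuclideanSpace ℝ (Fin d)))
    (i : ι) : MemLp (fun ω => A (ω i)) 2 (whiteNoise ι S) :=
  (((hasGaussianLaw_whiteNoise S).eval i).map_fun A).memLp_two

lemma covariance_dual_eval (S : Matrix (Fin d) (Fin d) ℝ)
    (A A' : StrongDual ℝ (EuclideanSpace ℝ (Fin d))) (i j : ι) [Decidable (i = j)] :
    cov[fun ω => A (ω i), fun ω => A' (ω j); whiteNoise ι S] =
      if i = j then cov[A, A'; multivariateGaussian 0 S] else 0 := by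
  split_ifs with h
  · subst h
    have h1 := (measurePreserving_eval (fun _ : ι => multivariateGaussian 0 S) i).map_eq
    have h2 := covariance_map (μ := Measure.pi fun _ : ι => multivariateGaussian 0 S)
      (Z := Function.eval i) (X := A) (Y := A') A.continuous.aestronglyMeasurable
      A'.continuous.aestronglyMeasurable (measurable_pi_apply i).aemeasurable
    rw [h1] at h2
    exact h2.symm
  · have h1 : iIndepFun (fun i (ω : ι → EuclideanSpace ℝ (Fin d)) => ω i) (whiteNoise ι S) :=
      iIndepFun_pi (X := fun _ x => x) (fun _ => by fun_prop)
    exact ((h1.indepFun h).comp A.measurable A'.measurable).covariance_eq_zero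
      (memLp_dual_eval S A i) (memLp_dual_eval S A' j)

lemma dual_lin (A : StrongDual ℝ (EuclideanSpace ℝ (Fin d))) (c : ι → ℝ)
    (ω : ι → EuclideanSpace ℝ (Fin d)) : A (lin c ω) = ∑ i, c i * A (ω i) := by
  simp [lin]

lemma memLp_dual_lin (S : Matrix (Fin d) (Fin d) ℝ) (A : StrongDual ℝ (EuclideanSpace ℝ (Fin d)))
    (c : ι → ℝ) : MemLp (fun ω => A (lin c ω)) 2 (whiteNoise ι S) := by
  simp_rw [dual_lin]
  exact memLp_finsetSum _ fun i _ => (memLp_dual_eval S A i).const_mul _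

/-- The covariance factors into the inner product of the coefficients and a term depending only on
`S`; orthogonality of coefficient vectors therefore gives decorrelation whatever `S` is. -/
lemma covariance_dual_lin (S : Matrix (Fin d) (Fin d) ℝ)
    (A A' : StrongDual ℝ (EuclideanSpace ℝ (Fin d))) (c c' : ι → ℝ) :
    cov[fun ω => A (lin c ω), fun ω => A' (lin c' ω); whiteNoise ι S] =
      (∑ i, c i * c' i) * cov[A, A'; multivariateGaussian 0 S] := by
  classical
  simp_rw [dual_lin]
  rw [covariance_fun_sum_fun_sum (fun i => (memLp_dual_eval S A i).const_mul _)
    (fun i => (memLp_dual_eval S A' i).const_mul _)]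
  simp_rw [covariance_const_mul_left, covariance_const_mul_right, covariance_dual_eval]
  simp [Finset.sum_mul, mul_assoc]

/-- Linear combinations of white noise with orthogonal coefficients are independent. -/
lemma indepFun_lin (S : Matrix (Fin d) (Fin d) ℝ) (x : α → ι → ℝ) (z : ι → ℝ)
    (h : ∀ a, ∑ i, x a i * z i = 0) :
    IndepFun (fun ω a => lin (x a) ω) (lin z) (whiteNoise ι S) := by
  classical
  refine HasGaussianLaw.indepFun_of_covariance_strongDual ?_ fun L A => ?_
  · have := (hasGaussianLaw_whiteNoise (ι := ι) S).map_fun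
      ((ContinuousLinearMap.pi fun a => ∑ i, x a i • ContinuousLinearMap.proj (R := ℝ)
        (φ := fun _ : ι => EuclideanSpace ℝ (Fin d)) i).prod
        (∑ i, z i • ContinuousLinearMap.proj (R := ℝ)
        (φ := fun _ : ι => EuclideanSpace ℝ (Fin d)) i))
    have he : (fun ω : ι → EuclideanSpace ℝ (Fin d) => ((fun a => lin (x a) ω), lin z ω)) =
        fun ω => ((ContinuousLinearMap.pi fun a => ∑ i, x a i • ContinuousLinearMap.proj (R := ℝ)
        (φ := fun _ : ι => EuclideanSpace ℝ (Fin d)) i).prod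
        (∑ i, z i • ContinuousLinearMap.proj (R := ℝ)
        (φ := fun _ : ι => EuclideanSpace ℝ (Fin d)) i)) (fun i => ω i) := by
      ext1 ω
      simp [lin]
    rw [he]
    exact this
  -- A functional on the product space is the sum of its restrictions to the factors, which reduces
  -- the covariance to pairs of single combinations.
  · have h1 : L ∘ (fun ω a => lin (x a) ω) = fun ω : ι → EuclideanSpace ℝ (Fin d) =>
        ∑ a, (L.comp (ContinuousLinearMap.single ℝ
          (fun _ : α => EuclideanSpace ℝ (Fin d)) a)) (lin (x a) ω) := by
      ext ω
      simp only [Function.comp_apply, ContinuousLinearMap.comp_apply, ← map_sum]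
      congr 1
      ext1 a
      simp [Finset.sum_apply, Pi.single_apply]
    rw [h1, covariance_fun_sum_left (fun a => memLp_dual_lin S _ (x a)) (Y := A ∘ lin z)
      (memLp_dual_lin S A z)]
    refine Finset.sum_eq_zero fun a _ => ?_
    have := covariance_dual_lin S (L.comp (ContinuousLinearMap.single ℝ
          (fun _ : α => EuclideanSpace ℝ (Fin d)) a)) A (x a) z
    rw [h a, zero_mul] at this
    exact this

lemma integral_dual_lin (S : Matrix (Fin d) (Fin d) ℝ)
    (A : StrongDual ℝ (EuclideanSpace ℝ (Fin d))) (c : ι → ℝ) :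
    ∫ ω, A (lin c ω) ∂(whiteNoise ι S) = 0 := by
  simp_rw [dual_lin]
  rw [integral_finsetSum _ fun i _ =>
    ((memLp_dual_eval S A i).integrable (by norm_num)).const_mul _]
  refine Finset.sum_eq_zero fun i _ => ?_
  rw [integral_const_mul]
  have h1 := (measurePreserving_eval (fun _ : ι => multivariateGaussian 0 S) i).map_eq
  have h2 : ∫ x, A x ∂(multivariateGaussian 0 S) = 0 := by
    rw [A.integral_comp_id_comm IsGaussian.integrable_id]; simp
  rw [← h1, integral_map (measurable_pi_apply i).aemeasurable (by fun_prop)] at h2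
  exact mul_eq_zero_of_right _ h2

lemma memLp_lin (S : Matrix (Fin d) (Fin d) ℝ) (c : ι → ℝ) :
    MemLp (lin c) 2 (whiteNoise ι S) := by
  have h : ∀ i, MemLp (fun ω : ι → EuclideanSpace ℝ (Fin d) => ω i) 2 (whiteNoise ι S) :=
    fun i => ((hasGaussianLaw_whiteNoise S).eval i).memLp_two
  exact memLp_finsetSum _ fun i _ => (h i).const_smul (c i)

lemma integral_lin (S : Matrix (Fin d) (Fin d) ℝ) (c : ι → ℝ) :
    ∫ ω, lin c ω ∂(whiteNoise ι S) = 0 := by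
  ext a
  have h := integral_dual_lin S (EuclideanSpace.proj a : StrongDual ℝ (EuclideanSpace ℝ (Fin d))) c
  rw [ContinuousLinearMap.integral_comp_comm _ ((memLp_lin S c).integrable (by norm_num))] at h
  simpa using h

lemma integral_norm_lin_sq {S : Matrix (Fin d) (Fin d) ℝ} (hS : S.PosSemidef) (c : ι → ℝ) :
    ∫ ω, ‖lin c ω‖ ^ 2 ∂(whiteNoise ι S) = (∑ i, c i ^ 2) * S.trace := by
  simp_rw [EuclideanSpace.real_norm_sq_eq]
  have hint : ∀ a, Integrable (fun ω : ι → EuclideanSpace ℝ (Fin d) => lin c ω a ^ 2)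
      (whiteNoise ι S) := fun a => (memLp_dual_lin S
    (EuclideanSpace.proj a : StrongDual ℝ (EuclideanSpace ℝ (Fin d))) c).integrable_sq
  rw [integral_finsetSum _ fun a _ => hint a]
  rw [Matrix.trace, Finset.mul_sum]
  refine Finset.sum_congr rfl fun a _ => ?_
  have h1 := covariance_dual_lin S
    (EuclideanSpace.proj a : StrongDual ℝ (EuclideanSpace ℝ (Fin d))) (EuclideanSpace.proj a) c c
  have h0 := integral_dual_lin S
    (EuclideanSpace.proj a : StrongDual ℝ (EuclideanSpace ℝ (Fin d))) c
  have h2 := covariance_eval_multivariateGaussian (μ := 0) hS a a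
  rw [covariance, h0] at h1
  simp only [PiLp.proj_apply, sub_zero] at h1
  simp_rw [pow_two, Matrix.diag_apply]
  rw [← h2]
  exact h1

lemma lintegral_norm_lin_sq {S : Matrix (Fin d) (Fin d) ℝ} (hS : S.PosSemidef) (c : ι → ℝ) :
    ∫⁻ ω, ENNReal.ofReal (‖lin c ω‖ ^ 2) ∂(whiteNoise ι S) =
      ENNReal.ofReal ((∑ i, c i ^ 2) * S.trace) := by
  rw [← integral_norm_lin_sq hS, ofReal_integral_eq_lintegral_ofReal]
  · exact (memLp_lin S c).integrable_norm_pow (by norm_num)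
  · exact .of_forall fun ω => by positivity

/-- Among all translates, a centred random vector has the smallest second moment. -/
lemma lintegral_norm_sq_le_lintegral_norm_sub_sq {Ω : Type*} [MeasurableSpace Ω] {P : Measure Ω}
    [IsProbabilityMeasure P] {Z : Ω → EuclideanSpace ℝ (Fin d)} (hZ : MemLp Z 2 P)
    (hZ0 : ∫ ω, Z ω ∂P = 0) (v : EuclideanSpace ℝ (Fin d)) :
    ∫⁻ ω, ENNReal.ofReal (‖Z ω‖ ^ 2) ∂P ≤ ∫⁻ ω, ENNReal.ofReal (‖v - Z ω‖ ^ 2) ∂P := by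
  have hi : Integrable (fun ω => ‖Z ω‖ ^ 2) P := hZ.integrable_norm_pow (by norm_num)
  have hv : Integrable (fun ω => ‖v - Z ω‖ ^ 2) P :=
    ((memLp_const v).sub hZ).integrable_norm_pow (by norm_num)
  have hZ1 : Integrable Z P := hZ.integrable (by norm_num)
  rw [← ofReal_integral_eq_lintegral_ofReal hi (.of_forall fun ω => by positivity),
    ← ofReal_integral_eq_lintegral_ofReal hv (.of_forall fun ω => by positivity)]
  refine ENNReal.ofReal_le_ofReal ?_
  have h1 : ∀ ω, ‖v - Z ω‖ ^ 2 = ‖v‖ ^ 2 - 2 * inner ℝ v (Z ω) + ‖Z ω‖ ^ 2 := fun ω => by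
    rw [norm_sub_sq_real]
  have h2 : Integrable (fun ω => 2 * inner ℝ v (Z ω)) P := (hZ1.const_inner v).const_mul 2
  simp_rw [h1]
  have h3 : Integrable (fun ω => ‖v‖ ^ 2 - 2 * inner ℝ v (Z ω)) P := (integrable_const _).sub h2
  rw [integral_add h3 hi, integral_sub (integrable_const _) h2,
    integral_const_mul, integral_inner hZ1, hZ0]
  simp only [integral_const, probReal_univ, one_smul, inner_zero_right]
  nlinarith [sq_nonneg ‖v‖]

/-- Bayes lower bound: if `u - ∑ α_a x_a` is orthogonal to all `x_a`, no function of the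
observations `lin x_a` predicts `lin u` with a smaller risk than the second moment of the
residual. -/
lemma le_lintegral_bayes {S : Matrix (Fin d) (Fin d) ℝ} (hS : S.PosSemidef) (x : α → ι → ℝ)
    (w : α → ℝ) (u : ι → ℝ)
    (h : ∀ a, ∑ i, x a i * (u - ∑ b, w b • x b) i = 0)
    {T : (α → EuclideanSpace ℝ (Fin d)) → EuclideanSpace ℝ (Fin d)} (hT : Measurable T) :
    ENNReal.ofReal ((∑ i, ((u - ∑ b, w b • x b) i) ^ 2) * S.trace) ≤
      ∫⁻ ω, ENNReal.ofReal (‖T (fun a => lin (x a) ω) - lin u ω‖ ^ 2) ∂(whiteNoise ι S) := by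
  set z := u - ∑ b, w b • x b with hz
  have hind := indepFun_lin S x z h
  have hX : Measurable fun (ω : ι → EuclideanSpace ℝ (Fin d)) a => lin (x a) ω := by fun_prop
  have hu : ∀ ω : ι → EuclideanSpace ℝ (Fin d),
      lin u ω = lin z ω + ∑ b, w b • lin (x b) ω := fun ω => by
    simp_rw [← lin_smul, ← lin_sum, ← lin_add, hz, sub_add_cancel]
  have h1 : ∀ ω : ι → EuclideanSpace ℝ (Fin d),
      ENNReal.ofReal (‖T (fun a => lin (x a) ω) - lin u ω‖ ^ 2) =
      (fun p : (α → EuclideanSpace ℝ (Fin d)) × EuclideanSpace ℝ (Fin d) =>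
        ENNReal.ofReal (‖(T p.1 - ∑ b, w b • p.1 b) - p.2‖ ^ 2))
        (fun a => lin (x a) ω, lin z ω) := fun ω => by
    simp only [hu]
    congr 3
    abel
  rw [lintegral_congr h1]
  have hm : Measurable (fun p : (α → EuclideanSpace ℝ (Fin d)) × EuclideanSpace ℝ (Fin d) =>
        ENNReal.ofReal (‖(T p.1 - ∑ b, w b • p.1 b) - p.2‖ ^ 2)) := by fun_prop
  -- By independence the integral is iterated. With the observations frozen, the prediction error is
  -- a constant vector minus the centred residual, and no constant beats zero.
  rw [← lintegral_map (g := fun ω => ((fun a => lin (x a) ω), lin z ω)) hm (by fun_prop),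
    (indepFun_iff_map_prod_eq_prod_map_map (by fun_prop) (by fun_prop)).1 hind,
    lintegral_prod _ hm.aemeasurable]
  have : IsProbabilityMeasure ((whiteNoise ι S).map fun ω a => lin (x a) ω) :=
    Measure.isProbabilityMeasure_map hX.aemeasurable
  rw [← lintegral_norm_lin_sq hS z]
  calc _ = ∫⁻ _, (∫⁻ ω, ENNReal.ofReal (‖lin z ω‖ ^ 2) ∂(whiteNoise ι S))
        ∂((whiteNoise ι S).map fun ω a => lin (x a) ω) := by simp
    _ ≤ _ := lintegral_mono fun y => by
      have hm' : Measurable fun v : EuclideanSpace ℝ (Fin d) =>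
        ENNReal.ofReal (‖(T y - ∑ b, w b • y b) - v‖ ^ 2) := by fun_prop
      rw [lintegral_map hm' (measurable_lin z)]
      exact lintegral_norm_sq_le_lintegral_norm_sub_sq (memLp_lin S z) (integral_lin S z) _

end WhiteNoise

/-! ### The observations as an affine image of white noise. -/

section Model

variable {B d : ℕ}

lemma multivariateGaussian_smul {S : Matrix (Fin d) (Fin d) ℝ} (hS : S.PosSemidef)
    (m : EuclideanSpace ℝ (Fin d)) (c : ℝ) :
    multivariateGaussian m (c ^ 2 • S) =
      (multivariateGaussian 0 S).map (fun x => m + c • x) := by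
  have h : (fun x : EuclideanSpace ℝ (Fin d) => m + c • x) = (fun x => m + x) ∘ (fun x => c • x) :=
    rfl
  rw [h, ← Measure.map_map (by fun_prop) (by fun_prop)]
  apply Measure.ext_of_charFun
  ext t
  rw [charFun_multivariateGaussian (hS.smul (sq_nonneg c)), charFun_map_const_add, charFun_map_smul,
    charFun_multivariateGaussian hS, ← Complex.exp_add]
  congr 1
  simp only [Matrix.smul_mulVec, dotProduct_smul, Matrix.mulVec_smul, inner_zero_right,
    WithLp.ofLp_smul, smul_dotProduct, real_inner_comm t m]
  push_cast [smul_eq_mul]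
  ring

/-- The observations as a function of the means and of the noise. -/
def observe (N : Fin B → ℕ) (s : Fin B → ℝ) (μ : Fin B → EuclideanSpace ℝ (Fin d))
    (y : (Σ k, Fin (N k)) → EuclideanSpace ℝ (Fin d)) : Sample N d :=
  fun k i => μ k + (√(N k : ℝ) * s k) • y ⟨k, i⟩

lemma measurable_observe (N : Fin B → ℕ) (s : Fin B → ℝ) :
    Measurable fun p : (Fin B → EuclideanSpace ℝ (Fin d)) ×
      ((Σ k, Fin (N k)) → EuclideanSpace ℝ (Fin d)) => observe N s p.1 p.2 := by
  unfold observe; fun_prop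

lemma jointLaw_eq_map {S : Matrix (Fin d) (Fin d) ℝ} (hS : S.PosSemidef) (N : Fin B → ℕ)
    (s : Fin B → ℝ) (μ : Fin B → EuclideanSpace ℝ (Fin d)) :
    jointLaw N s S μ = (whiteNoise (Σ k, Fin (N k)) S).map (observe N s μ) := by
  -- Passing to `Measure.infinitePi` gives access to the currying of the index `(k, i)`.
  have h1 : whiteNoise (Σ k, Fin (N k)) S = Measure.infinitePi
      fun _ : (Σ k, Fin (N k)) => multivariateGaussian 0 S := (Measure.infinitePi_eq_pi _).symm
  have h2 : observe N s μ = (fun (x : Sample N d) k i => μ k + (√(N k : ℝ) * s k) • x k i) ∘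
      (MeasurableEquiv.piCurry (fun (k : Fin B) (_ : Fin (N k)) => EuclideanSpace ℝ (Fin d))) := by
    ext; rfl
  have h3 := Measure.infinitePi_map_piCurry
    (fun (k : Fin B) (_ : Fin (N k)) => multivariateGaussian (0 : EuclideanSpace ℝ (Fin d)) S)
  rw [h2, ← Measure.map_map (by fun_prop) (by fun_prop), h1, h3]
  simp_rw [Measure.infinitePi_eq_pi]
  have hk : ∀ k, multivariateGaussian (μ k) (taskCov N s S k) =
      (multivariateGaussian 0 S).map (fun x => μ k + (√(N k : ℝ) * s k) • x) := fun k => by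
    rw [← multivariateGaussian_smul hS, taskCov, mul_pow, Real.sq_sqrt (Nat.cast_nonneg _)]
  have hm : ∀ k, Measurable fun x : EuclideanSpace ℝ (Fin d) => μ k + (√(N k : ℝ) * s k) • x :=
    fun k => by fun_prop
  have hp : ∀ k, IsProbabilityMeasure ((multivariateGaussian 0 S).map
      fun x : EuclideanSpace ℝ (Fin d) => μ k + (√(N k : ℝ) * s k) • x) := fun k =>
    Measure.isProbabilityMeasure_map (hm k).aemeasurable
  have hb : ∀ k, (Measure.pi fun _ : Fin (N k) => multivariateGaussian
        (0 : EuclideanSpace ℝ (Fin d)) S).map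
        (fun x i => μ k + (√(N k : ℝ) * s k) • x i) =
      Measure.pi fun _ : Fin (N k) => multivariateGaussian (μ k) (taskCov N s S k) := fun k => by
    rw [Measure.pi_map_pi (f := fun _ x => μ k + (√(N k : ℝ) * s k) • x)
      fun _ => (hm k).aemeasurable, hk]
  have hp' : ∀ k, IsProbabilityMeasure ((Measure.pi fun _ : Fin (N k) => multivariateGaussian
        (0 : EuclideanSpace ℝ (Fin d)) S).map
        (fun x i => μ k + (√(N k : ℝ) * s k) • x i)) := fun k => by
    rw [hb]; infer_instance
  rw [Measure.pi_map_pi (f := fun k (x : Fin (N k) → EuclideanSpace ℝ (Fin d)) i =>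
    μ k + (√(N k : ℝ) * s k) • x i) fun k =>
    (measurable_pi_lambda _ fun i => (hm k).comp (measurable_pi_apply i)).aemeasurable]
  simp_rw [hb]
  rfl

/-- Disintegration: white noise split into the part that drives the means and the observation
noise. -/
lemma lintegral_whiteNoise_sum {κ : Type*} [Fintype κ] {S : Matrix (Fin d) (Fin d) ℝ}
    (hS : S.PosSemidef) (N : Fin B → ℕ) (s : Fin B → ℝ)
    {U : (κ → EuclideanSpace ℝ (Fin d)) → Fin B → EuclideanSpace ℝ (Fin d)} (hU : Measurable U)
    {F : (κ → EuclideanSpace ℝ (Fin d)) → Sample N d → ℝ≥0∞}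
    (hF : Measurable fun p : (κ → EuclideanSpace ℝ (Fin d)) × Sample N d => F p.1 p.2) :
    ∫⁻ ω, F (fun a => ω (.inl a)) (observe N s (U fun a => ω (.inl a)) fun b => ω (.inr b))
        ∂(whiteNoise (κ ⊕ Σ k, Fin (N k)) S) =
      ∫⁻ p, ∫⁻ x, F p x ∂(jointLaw N s S (U p)) ∂(whiteNoise κ S) := by
  have h1 := measurePreserving_sumPiEquivProdPi (fun _ : κ ⊕ Σ k, Fin (N k) =>
    multivariateGaussian (0 : EuclideanSpace ℝ (Fin d)) S)
  have hm : Measurable fun p : (κ → EuclideanSpace ℝ (Fin d)) ×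
      ((Σ k, Fin (N k)) → EuclideanSpace ℝ (Fin d)) => F p.1 (observe N s (U p.1) p.2) :=
    hF.comp (measurable_fst.prodMk ((measurable_observe N s).comp
      ((hU.comp measurable_fst).prodMk measurable_snd)))
  have h2 := h1.lintegral_comp hm
  refine h2.trans ?_
  rw [lintegral_prod _ hm.aemeasurable]
  refine lintegral_congr fun p => ?_
  rw [jointLaw_eq_map hS, lintegral_map]
  · rfl
  · exact hF.comp (measurable_const.prodMk measurable_id)
  · exact (measurable_observe N s).comp (measurable_const.prodMk measurable_id)

end Model

/-! ### Concentration of the squared norm in high effective dimension. -/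

section Concentration

variable {d : ℕ}

lemma multivariateGaussian_diagonal {lam : Fin d → ℝ} (h : ∀ i, 0 ≤ lam i) :
    multivariateGaussian 0 (Matrix.diagonal lam) =
      (Measure.pi fun i => gaussianReal 0 (lam i).toNNReal).map (WithLp.toLp 2) := by
  apply Measure.ext_of_charFun (E := EuclideanSpace ℝ (Fin d))
  ext t
  rw [charFun_multivariateGaussian (Matrix.PosSemidef.diagonal h), charFun_pi]
  simp_rw [charFun_gaussianReal, ← Complex.exp_sum]
  congr 1
  simp only [inner_zero_right, Matrix.mulVec_diagonal, dotProduct]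
  push_cast
  simp only [zero_mul, mul_zero, zero_sub, Finset.sum_neg_distrib, Finset.sum_div]
  congr 1
  refine Finset.sum_congr rfl fun i _ => ?_
  rw [Real.coe_toNNReal _ (h i)]
  ring

lemma memLp_sq_gaussianReal (v : NNReal) :
    MemLp (fun x : ℝ => x ^ 2) 2 (gaussianReal 0 v) := by
  have h : MemLp (fun x : ℝ => x) ((4 : ℕ) : ℝ≥0∞) (gaussianReal 0 v) := by
    have := memLp_id_gaussianReal (μ := 0) (v := v) 4
    norm_num at this ⊢
    exact this
  rw [memLp_two_iff_integrable_sq (by fun_prop)]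
  have h4 := h.integrable_norm_pow (by norm_num)
  refine h4.congr (.of_forall fun x => ?_)
  simp only [Real.norm_eq_abs]
  rw [← pow_mul, Even.pow_abs (by decide)]

lemma variance_sq_gaussianReal {l : ℝ} (hl : 0 ≤ l) :
    Var[fun x => x ^ 2; gaussianReal 0 l.toNNReal] =
      l ^ 2 * Var[fun x => x ^ 2; gaussianReal 0 1] := by
  have h : gaussianReal 0 l.toNNReal = (gaussianReal 0 1).map (√l * ·) := by
    rw [gaussianReal_map_const_mul]
    congr 1
    · simp
    · ext; simp [Real.sq_sqrt hl, hl]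
  rw [h, variance_map (by fun_prop) (by fun_prop)]
  have : (fun x : ℝ => x ^ 2) ∘ (√l * ·) = fun x => l * x ^ 2 := by
    ext x; simp [mul_pow, Real.sq_sqrt hl]
  rw [this, variance_const_mul]

lemma integral_sq_gaussianReal {l : ℝ} (hl : 0 ≤ l) :
    ∫ x, x ^ 2 ∂(gaussianReal 0 l.toNNReal) = l := by
  have h := variance_id_gaussianReal (μ := 0) (v := l.toNNReal)
  rw [variance_eq_integral (by fun_prop)] at h
  simpa [hl] using h

/-- The squared norm is a sum of independent squares with means `lam i`, hence of mean 1; its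
variance is proportional to `∑ lam i ^ 2 ≤ t⁻¹ ∑ lam i = t⁻¹`. -/
lemma lintegral_sq_norm_sub_one {lam : Fin d → ℝ} {t : ℝ} (h : ∀ i, 0 ≤ lam i)
    (ht : ∀ i, lam i ≤ t⁻¹) (hsum : ∑ i, lam i = 1) :
    ∫⁻ x, ENNReal.ofReal ((‖x‖ ^ 2 - 1) ^ 2) ∂(multivariateGaussian 0 (Matrix.diagonal lam)) ≤
      ENNReal.ofReal (Var[fun x => x ^ 2; gaussianReal 0 1] / t) := by
  set P := Measure.pi fun i => gaussianReal 0 (lam i).toNNReal with hP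
  have hL : ∀ i, MemLp (fun x : Fin d → ℝ => x i ^ 2) 2 P := fun i =>
    (memLp_sq_gaussianReal _).comp_measurePreserving (measurePreserving_eval _ i)
  have hmean : ∫ x, ∑ i, x i ^ 2 ∂P = 1 := by
    rw [integral_finsetSum _ fun i _ => (hL i).integrable (by norm_num), ← hsum]
    refine Finset.sum_congr rfl fun i _ => ?_
    rw [← integral_sq_gaussianReal (h i),
      ← (measurePreserving_eval (fun i => gaussianReal 0 (lam i).toNNReal) i).map_eq,
      integral_map (measurable_pi_apply i).aemeasurable (by fun_prop)]
  have hvar : Var[fun x => ∑ i, x i ^ 2; P] ≤ Var[fun x => x ^ 2; gaussianReal 0 1] / t := by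
    have h1 := variance_sum_pi (μ := fun i => gaussianReal 0 (lam i).toNNReal)
      (X := fun i (x : ℝ) => x ^ 2) fun i => memLp_sq_gaussianReal _
    have h2 : (∑ i, fun x : Fin d → ℝ => x i ^ 2) = fun x => ∑ i, x i ^ 2 := by
      ext; simp
    rw [h2] at h1
    rw [h1, div_eq_mul_inv, mul_comm _ t⁻¹]
    simp_rw [variance_sq_gaussianReal (h _)]
    rw [← Finset.sum_mul]
    refine mul_le_mul_of_nonneg_right ?_ (variance_nonneg _ _)
    calc ∑ i, lam i ^ 2 ≤ ∑ i, t⁻¹ * lam i := Finset.sum_le_sum fun i _ => by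
          rw [pow_two]; exact mul_le_mul_of_nonneg_right (ht i) (h i)
      _ = t⁻¹ := by rw [← Finset.mul_sum, hsum, mul_one]
  have hLs : MemLp (fun x : Fin d → ℝ => ∑ i, x i ^ 2) 2 P := memLp_finsetSum _ fun i _ => hL i
  rw [variance_eq_integral hLs.aemeasurable, hmean] at hvar
  rw [multivariateGaussian_diagonal h, lintegral_map (by fun_prop) (by fun_prop)]
  simp_rw [EuclideanSpace.real_norm_sq_eq]
  rw [← ofReal_integral_eq_lintegral_ofReal]
  · exact ENNReal.ofReal_le_ofReal hvar
  · exact (hLs.sub (memLp_const 1)).integrable_sq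
  · exact .of_forall fun x => sq_nonneg _

end Concentration

/-! ### The hierarchical Gaussian prior and its posterior mean. -/

section Prior

variable {B J d : ℕ}

/-- Coefficients of the mean of task `k` in the hierarchical Gaussian prior
`μ_k = σ g_{c(k)} + r_{c(k)} g_k`, where `c(k)` is the group of `k`. -/
def meanCoef (c : Fin B → Fin J) (σ : ℝ) (r : Fin J → ℝ) (k : Fin B) : Fin J ⊕ Fin B → ℝ :=
  Sum.elim (fun j => if c k = j then σ else 0) (fun l => if l = k then r (c k) else 0)

/-- The means drawn from the hierarchical Gaussian prior. -/
def priorMean (c : Fin B → Fin J) (σ : ℝ) (r : Fin J → ℝ)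
    (p : Fin J ⊕ Fin B → EuclideanSpace ℝ (Fin d)) (k : Fin B) : EuclideanSpace ℝ (Fin d) :=
  lin (meanCoef c σ r k) p

lemma measurable_priorMean (c : Fin B → Fin J) (σ : ℝ) (r : Fin J → ℝ) :
    Measurable (priorMean (d := d) c σ r) := by
  unfold priorMean; fun_prop

lemma priorMean_apply (c : Fin B → Fin J) (σ : ℝ) (r : Fin J → ℝ)
    (p : Fin J ⊕ Fin B → EuclideanSpace ℝ (Fin d)) (k : Fin B) :
    priorMean c σ r p k = σ • p (.inl (c k)) + r (c k) • p (.inr k) := by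
  simp [priorMean, lin, meanCoef, ite_smul]

/-- Coefficients of the observation `(k, i)`. -/
def obsCoef (N : Fin B → ℕ) (s : Fin B → ℝ) (c : Fin B → Fin J) (σ : ℝ) (r : Fin J → ℝ)
    (a : Σ k, Fin (N k)) : (Fin J ⊕ Fin B) ⊕ (Σ k, Fin (N k)) → ℝ :=
  Sum.elim (meanCoef c σ r a.1) (Pi.single a (√(N a.1 : ℝ) * s a.1))

lemma observe_priorMean (N : Fin B → ℕ) (s : Fin B → ℝ) (c : Fin B → Fin J) (σ : ℝ)
    (r : Fin J → ℝ)
    (ω : (Fin J ⊕ Fin B) ⊕ (Σ k, Fin (N k)) → EuclideanSpace ℝ (Fin d)) (k : Fin B)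
    (i : Fin (N k)) :
    observe N s (priorMean c σ r fun a => ω (.inl a)) (fun b => ω (.inr b)) k i =
      lin (obsCoef N s c σ r ⟨k, i⟩) ω := by
  have h : ∑ x, (Pi.single ⟨k, i⟩ (√(N k : ℝ) * s k) : (Σ k, Fin (N k)) → ℝ) x • ω (.inr x) =
      (√(N k : ℝ) * s k) • ω (.inr ⟨k, i⟩) := by
    rw [Finset.sum_eq_single ⟨k, i⟩]
    · simp
    · intro b _ hb
      simp [Pi.single_eq_of_ne hb]
    · simp
  unfold observe priorMean obsCoef
  simp only [lin, Fintype.sum_sum_type, Sum.elim_inl, Sum.elim_inr, h]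

/-- The prior covariance (in units of the shape matrix) of the means of two tasks. -/
lemma sum_meanCoef_mul (c : Fin B → Fin J) (σ : ℝ) (r : Fin J → ℝ) (k l : Fin B) :
    ∑ i, meanCoef c σ r k i * meanCoef c σ r l i =
      (if c l = c k then σ ^ 2 else 0) + (if l = k then r (c k) ^ 2 else 0) := by
  simp only [meanCoef, Fintype.sum_sum_type, Sum.elim_inl, Sum.elim_inr, ite_mul, zero_mul,
    mul_ite, mul_zero, Finset.sum_ite_eq, Finset.mem_univ, if_true, Finset.sum_ite_eq', ← pow_two]
  congr 1
  · simp only [eq_comm]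
  · split_ifs with h
    · rw [h, pow_two]
    · rfl

/-- The total weight of the group of task `k`. -/
def groupWeight (s : Fin B → ℝ) (c : Fin B → Fin J) (r : Fin J → ℝ) (j : Fin J) : ℝ :=
  ∑ l, if c l = j then 1 / (r j ^ 2 + s l ^ 2) else 0

/-- The covariance (in units of the shape matrix) of the posterior residual of `μ_k` and the centre
of the group of `k`. -/
def sharedCov (s : Fin B → ℝ) (c : Fin B → Fin J) (h : ℝ) (r : Fin J → ℝ) (k : Fin B) : ℝ :=
  s k ^ 2 / (r (c k) ^ 2 + s k ^ 2) / (h + groupWeight s c r (c k))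

/-- The relative Bayes risk for task `k`. -/
def bayesRisk (s : Fin B → ℝ) (c : Fin B → Fin J) (h : ℝ) (r : Fin J → ℝ) (k : Fin B) : ℝ :=
  (sharedCov s c h r k + r (c k) ^ 2) / (r (c k) ^ 2 + s k ^ 2)

/-- The weight of the sample mean of task `l` in the posterior mean of task `k`. -/
def postWeight (s : Fin B → ℝ) (c : Fin B → Fin J) (h : ℝ) (r : Fin J → ℝ) (k l : Fin B) : ℝ :=
  (if c l = c k then sharedCov s c h r k / (r (c k) ^ 2 + s l ^ 2) else 0) +
    if l = k then r (c k) ^ 2 / (r (c k) ^ 2 + s k ^ 2) else 0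

lemma groupWeight_pos {s : Fin B → ℝ} (hs : ∀ k, 0 < s k) (c : Fin B → Fin J) (r : Fin J → ℝ)
    (k : Fin B) : 0 < groupWeight s c r (c k) := by
  unfold groupWeight
  have hp : ∀ l, 0 < 1 / (r (c k) ^ 2 + s l ^ 2) := fun l => by have := hs l; positivity
  refine Finset.sum_pos' (fun l _ => ?_) ⟨k, Finset.mem_univ k, ?_⟩
  · split_ifs
    · exact (hp l).le
    · exact le_rfl
  · simpa using hp k

/-- The normal equation at `l = k` gives the residual variance as `s k ^ 2` times the weight of the
task's own sample mean, so this weight is the relative risk. -/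
lemma postWeight_self (s : Fin B → ℝ) (c : Fin B → Fin J) (h : ℝ) (r : Fin J → ℝ) (k : Fin B) :
    postWeight s c h r k k = bayesRisk s c h r k := by
  simp [postWeight, bayesRisk, add_div]

/-- The normal equations of the posterior mean. -/
lemma normal_equations {s : Fin B → ℝ} (hs : ∀ k, 0 < s k) (c : Fin B → Fin J) {h σ : ℝ}
    (hh : 0 < h) (hσ : h * σ ^ 2 = 1) (r : Fin J → ℝ) (k l : Fin B) :
    ∑ i, meanCoef c σ r l i * meanCoef c σ r k i =
      ∑ m, postWeight s c h r k m * (∑ i, meanCoef c σ r l i * meanCoef c σ r m i) +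
        postWeight s c h r k l * s l ^ 2 := by
  simp_rw [sum_meanCoef_mul]
  have hW := groupWeight_pos hs c r k
  have hpos : ∀ l, r (c k) ^ 2 + s l ^ 2 ≠ 0 := fun l => by have := hs l; positivity
  have hsum : ∑ m, postWeight s c h r k m * ((if c m = c l then σ ^ 2 else 0) +
      if m = l then r (c l) ^ 2 else 0) =
      (∑ m, if c m = c l then postWeight s c h r k m else 0) * σ ^ 2 +
        postWeight s c h r k l * r (c l) ^ 2 := by
    simp only [mul_add, mul_ite, mul_zero, Finset.sum_add_distrib, Finset.sum_ite_eq',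
      Finset.mem_univ, if_true, Finset.sum_mul, ite_mul, zero_mul]
  rw [hsum]
  by_cases hl : c l = c k
  · have hg : (∑ m, if c m = c l then postWeight s c h r k m else 0) =
        sharedCov s c h r k * groupWeight s c r (c k) +
          r (c k) ^ 2 / (r (c k) ^ 2 + s k ^ 2) := by
      have h1 : ∀ m, (if c m = c l then postWeight s c h r k m else 0) =
          sharedCov s c h r k * (if c m = c k then 1 / (r (c k) ^ 2 + s m ^ 2) else 0) +
            if m = k then r (c k) ^ 2 / (r (c k) ^ 2 + s k ^ 2) else 0 := fun m => by
        unfold postWeight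
        rw [hl]
        by_cases hm : c m = c k
        · simp [hm, div_eq_mul_inv]
        · have : m ≠ k := fun h => hm (by rw [h])
          simp [hm, this]
      simp_rw [h1]
      rw [Finset.sum_add_distrib, ← Finset.mul_sum]
      simp [groupWeight]
    have hl2 : postWeight s c h r k l * (r (c k) ^ 2 + s l ^ 2) =
        sharedCov s c h r k + if l = k then r (c k) ^ 2 else 0 := by
      unfold postWeight
      by_cases hlk : l = k
      · subst hlk
        have := hpos l
        simp only [if_true]; field_simp
      · have := hpos l
        simp only [hl, hlk, if_true, if_false, add_zero]; field_simp
    have hc : sharedCov s c h r k * (h + groupWeight s c r (c k)) =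
        s k ^ 2 / (r (c k) ^ 2 + s k ^ 2) := by
      unfold sharedCov
      have : h + groupWeight s c r (c k) ≠ 0 := by positivity
      field_simp
    have hc2 : r (c k) ^ 2 / (r (c k) ^ 2 + s k ^ 2) = 1 - s k ^ 2 / (r (c k) ^ 2 + s k ^ 2) := by
      have := hpos k
      field_simp; ring
    -- The weights within the group now sum to `1 - h * sharedCov`. Multiplied by `σ ^ 2`, the
    -- defect is exactly `sharedCov` because `h * σ ^ 2 = 1`, and it cancels the same term in `hl2`.
    rw [hg, hc2, ← hc, hl]
    simp only [if_true]
    have hkl : (if k = l then r (c k) ^ 2 else 0) = if l = k then r (c k) ^ 2 else 0 := by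
      simp only [eq_comm]
    rw [hkl]
    linear_combination (-1 : ℝ) * hl2 + sharedCov s c h r k * hσ
  -- Different groups are independent under the prior: all terms vanish.
  · have hlk : l ≠ k := fun h => hl (by rw [h])
    have h1 : ∀ m, (if c m = c l then postWeight s c h r k m else 0) = 0 := fun m => by
      split_ifs with hm
      · have h2 : c m ≠ c k := by rw [hm]; exact hl
        have h3 : m ≠ k := fun h => h2 (by rw [h])
        simp [postWeight, h2, h3]
      · rfl
    simp_rw [h1]
    simp [postWeight, hl, hlk, Ne.symm hl, Ne.symm hlk]

/-- The Bayes risk of every estimator under the hierarchical Gaussian prior. -/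
lemma bayesRisk_le_lintegral {N : Fin B → ℕ} (hN : ∀ k, 0 < N k) {s : Fin B → ℝ}
    (hs : ∀ k, 0 < s k) (c : Fin B → Fin J) {h σ : ℝ} (hh : 0 < h) (hσ : h * σ ^ 2 = 1)
    (r : Fin J → ℝ) {S : Matrix (Fin d) (Fin d) ℝ} (hS : S.PosSemidef) (htr : S.trace = 1)
    {T : Sample N d → EuclideanSpace ℝ (Fin d)} (hT : Measurable T) (k : Fin B) :
    ENNReal.ofReal (bayesRisk s c h r k * s k ^ 2) ≤
      ∫⁻ ω, ENNReal.ofReal (‖T (observe N s (priorMean c σ r fun a => ω (.inl a))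
        fun b => ω (.inr b)) - priorMean c σ r (fun a => ω (.inl a)) k‖ ^ 2)
        ∂(whiteNoise ((Fin J ⊕ Fin B) ⊕ (Σ k, Fin (N k))) S) := by
  set x := obsCoef N s c σ r with hx
  -- The posterior mean depends on each bag through its sample mean, so the weight is spread evenly
  -- over the bag.
  set w : (Σ k, Fin (N k)) → ℝ := fun a => postWeight s c h r k a.1 / N a.1 with hw
  set u : (Fin J ⊕ Fin B) ⊕ (Σ k, Fin (N k)) → ℝ := Sum.elim (meanCoef c σ r k) 0 with hu
  have hN' : ∀ k, (N k : ℝ) ≠ 0 := fun k => by have := hN k; positivity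
  have hzl : ∀ i, (u - ∑ b, w b • x b) (.inl i) =
      meanCoef c σ r k i - ∑ m, postWeight s c h r k m * meanCoef c σ r m i := fun i => by
    simp only [hu, hx, hw, obsCoef, Pi.sub_apply, Sum.elim_inl, Finset.sum_apply, Pi.smul_apply,
      smul_eq_mul, Fintype.sum_sigma, Finset.sum_const, Finset.card_univ, Fintype.card_fin,
      nsmul_eq_mul]
    congr 1
    refine Finset.sum_congr rfl fun m _ => ?_
    have := hN' m
    field_simp
  have hzr : ∀ a, (u - ∑ b, w b • x b) (.inr a) =
      - (postWeight s c h r k a.1 / N a.1 * (√(N a.1 : ℝ) * s a.1)) := fun a => by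
    simp only [hu, hx, hw, obsCoef, Pi.sub_apply, Sum.elim_inr, Finset.sum_apply, Pi.smul_apply,
      smul_eq_mul, Pi.zero_apply, zero_sub, neg_inj]
    rw [Finset.sum_eq_single a]
    · simp
    · intro b _ hb
      simp [Pi.single_eq_of_ne (Ne.symm hb)]
    · simp
  have hinner : ∀ l, ∑ i, meanCoef c σ r l i *
      (meanCoef c σ r k i - ∑ m, postWeight s c h r k m * meanCoef c σ r m i) =
        postWeight s c h r k l * s l ^ 2 := fun l => by
    have h1 := normal_equations hs c hh hσ r k l
    simp_rw [mul_sub, Finset.sum_sub_distrib, h1, Finset.mul_sum]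
    rw [Finset.sum_comm]
    simp_rw [mul_left_comm]
    ring
  -- For an observation of task `l`, the prior coordinates contribute `postWeight * s l ^ 2` by
  -- `hinner`, and its own noise coordinate contributes the opposite.
  have horth : ∀ a, ∑ i, x a i * (u - ∑ b, w b • x b) i = 0 := fun a => by
    rw [Fintype.sum_sum_type]
    simp_rw [hzl, hzr]
    simp only [hx, obsCoef, Sum.elim_inl, Sum.elim_inr]
    rw [hinner, Finset.sum_eq_single a]
    · rw [Pi.single_eq_same]
      have h1 := Real.sq_sqrt (Nat.cast_nonneg (α := ℝ) (N a.1))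
      have := hN' a.1
      field_simp
      rw [h1]; ring
    · intro b _ hb
      simp [Pi.single_eq_of_ne hb]
    · simp
  have hT' : Measurable fun y : (Σ k, Fin (N k)) → EuclideanSpace ℝ (Fin d) =>
      T (fun k i => y ⟨k, i⟩) := hT.comp (by fun_prop)
  have key := le_lintegral_bayes hS x w u horth hT'
  have hval : ∑ i, ((u - ∑ b, w b • x b) i) ^ 2 = bayesRisk s c h r k * s k ^ 2 := by
    -- Pythagoras: the residual is orthogonal to the projection, so its squared norm is its inner
    -- product with `u`.
    have h1 : ∑ i, ((u - ∑ b, w b • x b) i) ^ 2 = ∑ i, u i * (u - ∑ b, w b • x b) i := by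
      have h2 : ∀ z : (Fin J ⊕ Fin B) ⊕ (Σ k, Fin (N k)) → ℝ, (∀ a, ∑ i, x a i * z i = 0) →
          ∑ i, (∑ b, w b • x b) i * z i = 0 := fun z hz => by
        simp only [Finset.sum_apply, Finset.sum_mul, Pi.smul_apply, smul_eq_mul]
        rw [Finset.sum_comm]
        refine Finset.sum_eq_zero fun a _ => ?_
        simp_rw [mul_assoc]
        rw [← Finset.mul_sum, hz, mul_zero]
      rw [← sub_zero (∑ i, u i * _), ← h2 _ horth, ← Finset.sum_sub_distrib]
      refine Finset.sum_congr rfl fun i _ => ?_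
      simp only [Pi.sub_apply]; ring
    rw [h1, Fintype.sum_sum_type]
    simp_rw [hzl, hzr]
    simp only [hu, Sum.elim_inl, Sum.elim_inr, Pi.zero_apply, zero_mul, Finset.sum_const_zero,
      add_zero]
    rw [hinner, postWeight_self]
  rw [hval, htr, mul_one] at key
  refine key.trans (le_of_eq (lintegral_congr fun ω => ?_))
  have h1 : (fun k i => lin (x ⟨k, i⟩) ω) = observe N s (priorMean c σ r fun a => ω (.inl a))
      fun b => ω (.inr b) := by
    funext k i; exact (observe_priorMean N s c σ r ω k i).symm
  have h2 : lin u ω = priorMean c σ r (fun a => ω (.inl a)) k := by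
    simp [lin, hu, priorMean]
  rw [h1, h2]

end Prior

/-! ### Clipping, and restriction of the prior to the model. -/

section Truncation

variable {B J d : ℕ}

/-- The estimate `y` if it is within distance `R` of the reference `y₀`, and `y₀` otherwise. -/
def clip (R : ℝ) (y₀ y : EuclideanSpace ℝ (Fin d)) : EuclideanSpace ℝ (Fin d) :=
  if ‖y - y₀‖ ≤ R then y else y₀

lemma measurable_clip {Ω : Type*} [MeasurableSpace Ω] {R : ℝ}
    {f g : Ω → EuclideanSpace ℝ (Fin d)} (hf : Measurable f) (hg : Measurable g) :
    Measurable fun ω => clip R (f ω) (g ω) :=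
  Measurable.ite (measurableSet_le (hg.sub hf).norm measurable_const) hg hf

/-- Here `m + a • g` is an observation of `m`. If clipping acts and `‖g‖ ≤ 2`, then `y` is at
distance at least `2 * a` from `m`, so the observation is no worse; if `‖g‖ > 2`, the loss `a ^ 2 *
‖g‖ ^ 2` is absorbed by the deviation term. -/
lemma norm_clip_sub_sq_le {a : ℝ} (ha : 0 < a) (y m g : EuclideanSpace ℝ (Fin d)) :
    ‖clip (4 * a) (m + a • g) y - m‖ ^ 2 ≤ ‖y - m‖ ^ 2 + 3 * a ^ 2 * (‖g‖ ^ 2 - 1) ^ 2 := by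
  unfold clip
  split_ifs with h
  · have : 0 ≤ 3 * a ^ 2 * (‖g‖ ^ 2 - 1) ^ 2 := by positivity
    linarith
  · rw [add_sub_cancel_left, norm_smul, mul_pow, Real.norm_eq_abs, sq_abs]
    rcases le_or_gt (‖g‖ ^ 2) 4 with hg | hg
    · have hg2 : ‖g‖ ≤ 2 := by nlinarith [norm_nonneg g]
      have h1 : ‖y - (m + a • g)‖ ≤ ‖y - m‖ + a * ‖g‖ := by
        have := norm_sub_le (y - m) (a • g)
        rwa [norm_smul, Real.norm_eq_abs, abs_of_pos ha, sub_sub] at this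
      have h2 : a * ‖g‖ ≤ ‖y - m‖ := by nlinarith
      have h3 : (a * ‖g‖) ^ 2 ≤ ‖y - m‖ ^ 2 := pow_le_pow_left₀ (by positivity) h2 2
      have : 0 ≤ 3 * a ^ 2 * (‖g‖ ^ 2 - 1) ^ 2 := by positivity
      rw [mul_pow] at h3
      linarith
    · have h1 : ‖g‖ ^ 2 ≤ 3 * (‖g‖ ^ 2 - 1) ^ 2 := by nlinarith
      have h2 : a ^ 2 * ‖g‖ ^ 2 ≤ a ^ 2 * (3 * (‖g‖ ^ 2 - 1) ^ 2) :=
        mul_le_mul_of_nonneg_left h1 (sq_nonneg a)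
      nlinarith [sq_nonneg ‖y - m‖]

/-- A bound free of `y`, needed where nothing is known about the estimator. The constant comes from
`(4 + x) ^ 2 ≤ 36 + 3 * (x ^ 2 - 1) ^ 2`. -/
lemma norm_clip_sub_sq_le' {a : ℝ} (ha : 0 < a) (y m g : EuclideanSpace ℝ (Fin d)) :
    ‖clip (4 * a) (m + a • g) y - m‖ ^ 2 ≤ 36 * a ^ 2 + 3 * a ^ 2 * (‖g‖ ^ 2 - 1) ^ 2 := by
  have hb : ‖clip (4 * a) (m + a • g) y - (m + a • g)‖ ≤ 4 * a := by
    unfold clip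
    split_ifs with h
    · exact h
    · simp [ha.le]
  have h1 : ‖clip (4 * a) (m + a • g) y - m‖ ≤ a * (4 + ‖g‖) := by
    have h2 := norm_add_le (clip (4 * a) (m + a • g) y - (m + a • g)) (a • g)
    rw [norm_smul, Real.norm_eq_abs, abs_of_pos ha] at h2
    have h3 : clip (4 * a) (m + a • g) y - (m + a • g) + a • g =
      clip (4 * a) (m + a • g) y - m := by abel
    rw [h3] at h2
    linarith
  have h2 : ‖clip (4 * a) (m + a • g) y - m‖ ^ 2 ≤ (a * (4 + ‖g‖)) ^ 2 :=
    pow_le_pow_left₀ (norm_nonneg _) h1 2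
  have h3 : (4 + ‖g‖) ^ 2 ≤ 36 + 3 * (‖g‖ ^ 2 - 1) ^ 2 := by
    nlinarith [sq_nonneg (4 - ‖g‖), sq_nonneg (‖g‖ ^ 2 - 1 - 1)]
  rw [mul_pow] at h2
  nlinarith [mul_le_mul_of_nonneg_left h3 (sq_nonneg a)]

/-- The prior draws for which no group shift exceeds half of the allowed diameter. -/
def goodSet (B J d : ℕ) (h : ℝ) : Set (Fin J ⊕ Fin B → EuclideanSpace ℝ (Fin d)) :=
  {p | ∀ l : Fin B, (1 - h) * ‖p (.inr l)‖ ≤ 1}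

lemma measurableSet_goodSet (h : ℝ) : MeasurableSet (goodSet B J d h) := by
  have : goodSet B J d h = ⋂ l : Fin B, {p | (1 - h) * ‖p (.inr l)‖ ≤ 1} := by
    ext; simp [goodSet]
  rw [this]
  exact MeasurableSet.iInter fun l =>
    measurableSet_le (((measurable_pi_apply _).norm).const_mul _) measurable_const

/-- The shared centre cancels in differences within a group, leaving two individual shifts of norm
at most `ζ j / 2`; hence the factor one half in the theorem. -/
lemma priorMean_mem_meanClass {C : Fin J → Finset (Fin B)} {c : Fin B → Fin J}
    (hc : ∀ k j, k ∈ C j ↔ c k = j) {ζ : Fin J → ℝ} (hζ : ∀ j, 0 ≤ ζ j) {h σ : ℝ} (hh : h < 1)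
    {p : Fin J ⊕ Fin B → EuclideanSpace ℝ (Fin d)} (hp : p ∈ goodSet B J d h) :
    priorMean c σ (fun j => (1 - h) * (ζ j / 2)) p ∈ meanClass d C ζ := by
  intro j
  refine Metric.diam_le_of_forall_dist_le (hζ j) ?_
  rintro _ ⟨k, hk, rfl⟩ _ ⟨l, hl, rfl⟩
  have hk' : c k = j := (hc k j).1 hk
  have hl' : c l = j := (hc l j).1 hl
  rw [priorMean_apply, priorMean_apply, hk', hl', dist_add_left, dist_eq_norm]
  have hb : ∀ l : Fin B, ‖((1 - h) * (ζ j / 2)) • p (.inr l)‖ ≤ ζ j / 2 := fun l => by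
    have h1 := hp l
    have h2 : 0 ≤ ζ j / 2 := by have := hζ j; positivity
    rw [norm_smul, Real.norm_eq_abs, abs_of_nonneg (mul_nonneg (by linarith) h2)]
    nlinarith
  have := norm_sub_le (((1 - h) * (ζ j / 2)) • p (.inr k)) (((1 - h) * (ζ j / 2)) • p (.inr l))
  linarith [hb k, hb l]

/-- A pointwise Chebyshev bound: some `‖p (.inr l)‖` exceeds `1 / (1 - h) ≥ 1 + h`, so its square
exceeds 1 by at least `h`. -/
lemma one_le_sum_of_notMem_goodSet {h : ℝ} (h0 : 0 < h) (h1 : h < 1)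
    {p : Fin J ⊕ Fin B → EuclideanSpace ℝ (Fin d)} (hp : p ∉ goodSet B J d h) :
    1 ≤ ∑ l : Fin B, (1 / h ^ 2) * (‖p (.inr l)‖ ^ 2 - 1) ^ 2 := by
  simp only [goodSet, Set.mem_ofPred_eq, not_forall, not_le] at hp
  obtain ⟨l, hl⟩ := hp
  refine le_trans ?_ (Finset.single_le_sum (fun l _ => by positivity) (Finset.mem_univ l))
  have h2 : 1 + h ≤ ‖p (.inr l)‖ := by nlinarith [norm_nonneg (p (.inr l))]
  have h3 : h ≤ ‖p (.inr l)‖ ^ 2 - 1 := by nlinarith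
  rw [one_div, inv_mul_eq_div, one_le_div (by positivity)]
  exact pow_le_pow_left₀ h0.le h3 2

lemma lintegral_sq_norm_eval_sub_one {ι : Type*} [Fintype ι] {lam : Fin d → ℝ} {t : ℝ}
    (h : ∀ i, 0 ≤ lam i) (ht : ∀ i, lam i ≤ t⁻¹) (hsum : ∑ i, lam i = 1) (i : ι) {b : ℝ}
    (hb : 0 ≤ b) :
    ∫⁻ ω, ENNReal.ofReal (b * (‖ω i‖ ^ 2 - 1) ^ 2) ∂(whiteNoise ι (Matrix.diagonal lam)) ≤
      ENNReal.ofReal (b * (Var[fun x => x ^ 2; gaussianReal 0 1] / t)) := by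
  have h1 := (measurePreserving_eval
    (fun _ : ι => multivariateGaussian 0 (Matrix.diagonal lam)) i).lintegral_comp
    (f := fun x => ENNReal.ofReal (b * (‖x‖ ^ 2 - 1) ^ 2)) (by fun_prop)
  refine h1.le.trans ?_
  simp_rw [ENNReal.ofReal_mul hb]
  rw [lintegral_const_mul _ (by fun_prop)]
  gcongr
  exact lintegral_sq_norm_sub_one h ht hsum

/-- Bayes risk restricted to the good set. -/
lemma bayesRisk_le_lintegral_goodSet {N : Fin B → ℕ} (hN : ∀ k, 0 < N k) {s : Fin B → ℝ}
    (hs : ∀ k, 0 < s k) (c : Fin B → Fin J) {h σ : ℝ} (h0 : 0 < h) (h1 : h < 1)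
    (hσ : h * σ ^ 2 = 1) (r : Fin J → ℝ) {lam : Fin d → ℝ} {t : ℝ}
    (hlam : ∀ i, 0 ≤ lam i) (ht0 : 0 < t) (ht : ∀ i, lam i ≤ t⁻¹) (hsum : ∑ i, lam i = 1)
    {T : Sample N d → EuclideanSpace ℝ (Fin d)} (hT : Measurable T) (k : Fin B) :
    ENNReal.ofReal (bayesRisk s c h r k * s k ^ 2) ≤
      ∫⁻ ω, (goodSet B J d h).indicator (fun _ => 1) (fun a => ω (.inl a)) *
        ENNReal.ofReal (‖T (observe N s (priorMean c σ r fun a => ω (.inl a))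
        fun b => ω (.inr b)) - priorMean c σ r (fun a => ω (.inl a)) k‖ ^ 2)
        ∂(whiteNoise ((Fin J ⊕ Fin B) ⊕ (Σ k, Fin (N k))) (Matrix.diagonal lam)) +
      ENNReal.ofReal ((3 + 36 * B / h ^ 2) * (N k * s k ^ 2) *
        (Var[fun x => x ^ 2; gaussianReal 0 1] / t)) := by
  set v := Var[fun x => x ^ 2; gaussianReal 0 1] / t with hv
  have hv0 : 0 ≤ v := div_nonneg (variance_nonneg _ _) ht0.le
  set a := √(N k : ℝ) * s k with ha
  have hNk : (0 : ℝ) < N k := by exact_mod_cast hN k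
  have ha0 : 0 < a := mul_pos (Real.sqrt_pos.2 hNk) (hs k)
  have ha2 : a ^ 2 = N k * s k ^ 2 := by rw [ha, mul_pow, Real.sq_sqrt hNk.le]
  set i₀ : Fin (N k) := ⟨0, hN k⟩
  -- The Bayes bound is applied to `T` clipped around the first observation of the bag, whose noise
  -- has scale `a`.
  have hT' : Measurable fun x : Sample N d => clip (4 * a) (x k i₀) (T x) :=
    measurable_clip (by fun_prop) hT
  have hS : (Matrix.diagonal lam).PosSemidef := Matrix.PosSemidef.diagonal hlam
  have htr : (Matrix.diagonal lam).trace = 1 := by rw [Matrix.trace_diagonal, hsum]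
  refine (bayesRisk_le_lintegral hN hs c h0 hσ r hS htr hT' k).trans ?_
  set P := whiteNoise ((Fin J ⊕ Fin B) ⊕ (Σ k, Fin (N k))) (Matrix.diagonal lam)
  have hpt : ∀ ω : (Fin J ⊕ Fin B) ⊕ (Σ k, Fin (N k)) → EuclideanSpace ℝ (Fin d),
      ENNReal.ofReal (‖clip (4 * a) (observe N s (priorMean c σ r fun a => ω (.inl a))
        (fun b => ω (.inr b)) k i₀) (T (observe N s (priorMean c σ r fun a => ω (.inl a))
        fun b => ω (.inr b))) - priorMean c σ r (fun a => ω (.inl a)) k‖ ^ 2) ≤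
      (goodSet B J d h).indicator (fun _ => 1) (fun a => ω (.inl a)) *
        ENNReal.ofReal (‖T (observe N s (priorMean c σ r fun a => ω (.inl a))
        fun b => ω (.inr b)) - priorMean c σ r (fun a => ω (.inl a)) k‖ ^ 2) +
      (ENNReal.ofReal (3 * a ^ 2 * (‖ω (.inr ⟨k, i₀⟩)‖ ^ 2 - 1) ^ 2) +
        ∑ l : Fin B, ENNReal.ofReal
          (36 * a ^ 2 / h ^ 2 * (‖ω (.inl (.inr l))‖ ^ 2 - 1) ^ 2)) := fun ω => by
    set m := priorMean c σ r (fun a => ω (.inl a)) k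
    have hobs : observe N s (priorMean c σ r fun a => ω (.inl a))
        (fun b => ω (.inr b)) k i₀ = m + a • ω (.inr ⟨k, i₀⟩) := rfl
    rw [hobs]
    set y := T (observe N s (priorMean c σ r fun a => ω (.inl a)) fun b => ω (.inr b))
    -- On the good set clipping costs only the deviation term; off it the constant `36 * a ^ 2` is
    -- paid by the Chebyshev sum.
    by_cases hg : (fun a => ω (.inl a)) ∈ goodSet B J d h
    · rw [Set.indicator_of_mem hg, one_mul, ← add_assoc]
      refine le_trans ?_ le_self_add
      rw [← ENNReal.ofReal_add (by positivity) (by positivity)]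
      exact ENNReal.ofReal_le_ofReal (norm_clip_sub_sq_le ha0 y m _)
    · rw [Set.indicator_of_notMem hg, zero_mul, zero_add,
        ← ENNReal.ofReal_sum_of_nonneg (fun l _ => by positivity),
        ← ENNReal.ofReal_add (by positivity) (by positivity)]
      refine ENNReal.ofReal_le_ofReal ((norm_clip_sub_sq_le' ha0 y m _).trans ?_)
      have h2 := one_le_sum_of_notMem_goodSet h0 h1 hg
      have h3 : ∑ l : Fin B, 36 * a ^ 2 / h ^ 2 * (‖ω (.inl (.inr l))‖ ^ 2 - 1) ^ 2 =
          36 * a ^ 2 * ∑ l : Fin B, (1 / h ^ 2) * (‖ω (.inl (.inr l))‖ ^ 2 - 1) ^ 2 := by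
        rw [Finset.mul_sum]
        exact Finset.sum_congr rfl fun l _ => by ring
      rw [h3]
      nlinarith [sq_nonneg a]
  refine (lintegral_mono hpt).trans ?_
  have hm1 : Measurable fun ω : (Fin J ⊕ Fin B) ⊕ (Σ k, Fin (N k)) → EuclideanSpace ℝ (Fin d) =>
      ENNReal.ofReal (3 * a ^ 2 * (‖ω (.inr ⟨k, i₀⟩)‖ ^ 2 - 1) ^ 2) := by fun_prop
  have hm2 : ∀ l : Fin B,
      Measurable fun ω : (Fin J ⊕ Fin B) ⊕ (Σ k, Fin (N k)) → EuclideanSpace ℝ (Fin d) =>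
      ENNReal.ofReal (36 * a ^ 2 / h ^ 2 * (‖ω (.inl (.inr l))‖ ^ 2 - 1) ^ 2) := fun l => by
    fun_prop
  have hm3 : Measurable fun ω : (Fin J ⊕ Fin B) ⊕ (Σ k, Fin (N k)) → EuclideanSpace ℝ (Fin d) =>
      ENNReal.ofReal (3 * a ^ 2 * (‖ω (.inr ⟨k, i₀⟩)‖ ^ 2 - 1) ^ 2) +
        ∑ l : Fin B, ENNReal.ofReal
          (36 * a ^ 2 / h ^ 2 * (‖ω (.inl (.inr l))‖ ^ 2 - 1) ^ 2) :=
    hm1.add (Finset.measurable_fun_sum _ fun l _ => hm2 l)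
  rw [lintegral_add_right _ hm3, lintegral_add_left hm1, lintegral_finsetSum _ fun l _ => hm2 l]
  gcongr
  calc _ ≤ ENNReal.ofReal (3 * a ^ 2 * v) +
        ∑ _l : Fin B, ENNReal.ofReal (36 * a ^ 2 / h ^ 2 * v) := by
        gcongr
        · exact lintegral_sq_norm_eval_sub_one hlam ht hsum _ (by positivity)
        · exact lintegral_sq_norm_eval_sub_one hlam ht hsum _ (by positivity)
    _ = _ := by
      rw [← ENNReal.ofReal_sum_of_nonneg (fun l _ => by positivity),
        ← ENNReal.ofReal_add (by positivity) (Finset.sum_nonneg fun l _ => by positivity)]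
      congr 1
      rw [Finset.sum_const, Finset.card_univ, Fintype.card_fin, nsmul_eq_mul, ← ha2]
      ring

/-! ### From the average risk under the prior to the minimax risk. -/

lemma lintegral_sum_div_div {Ω : Type*} [MeasurableSpace Ω] (P : Measure Ω)
    {f : Fin B → Ω → ℝ≥0∞} (hf : ∀ k, Measurable (f k)) (w : Fin B → ℝ≥0∞) (b : ℝ≥0∞) :
    ∫⁻ ω, (∑ k, f k ω / w k) / b ∂P = (∑ k, (∫⁻ ω, f k ω ∂P) / w k) / b := by
  simp_rw [div_eq_mul_inv]
  rw [lintegral_mul_const _ (Finset.measurable_fun_sum _ fun k _ => (hf k).mul_const _),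
    lintegral_finsetSum _ fun k _ => (hf k).mul_const _]
  simp_rw [lintegral_mul_const _ (hf _)]

lemma compoundRisk_eq_lintegral {N : Fin B → ℕ} {s : Fin B → ℝ}
    (S : Matrix (Fin d) (Fin d) ℝ) (μ : Fin B → EuclideanSpace ℝ (Fin d))
    {T : Sample N d → Fin B → EuclideanSpace ℝ (Fin d)} (hT : Measurable T) :
    compoundRisk N s S μ T = ∫⁻ x, (∑ k, ENNReal.ofReal (‖T x k - μ k‖ ^ 2) /
      ENNReal.ofReal (s k ^ 2)) / (B : ℝ≥0∞) ∂(jointLaw N s S μ) :=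
  (lintegral_sum_div_div (jointLaw N s S μ) (f := fun k x => ENNReal.ofReal (‖T x k - μ k‖ ^ 2))
    (fun k => (((((measurable_pi_apply k).comp hT).sub_const _).norm).pow_const 2).ennreal_ofReal)
    (fun k => ENNReal.ofReal (s k ^ 2)) B).symm

lemma measurable_observe_priorMean (N : Fin B → ℕ) (s : Fin B → ℝ) (c : Fin B → Fin J) (σ : ℝ)
    (r : Fin J → ℝ) :
    Measurable fun ω : (Fin J ⊕ Fin B) ⊕ (Σ k, Fin (N k)) → EuclideanSpace ℝ (Fin d) =>
      observe N s (priorMean c σ r fun a => ω (.inl a)) fun b => ω (.inr b) := by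
  have h1 : Measurable fun ω : (Fin J ⊕ Fin B) ⊕ (Σ k, Fin (N k)) → EuclideanSpace ℝ (Fin d) =>
      (fun a => ω (.inl a) : Fin J ⊕ Fin B → EuclideanSpace ℝ (Fin d)) :=
    measurable_pi_lambda _ fun a => measurable_pi_apply _
  have h2 : Measurable fun ω : (Fin J ⊕ Fin B) ⊕ (Σ k, Fin (N k)) → EuclideanSpace ℝ (Fin d) =>
      (fun b => ω (.inr b) : (Σ k, Fin (N k)) → EuclideanSpace ℝ (Fin d)) :=
    measurable_pi_lambda _ fun a => measurable_pi_apply _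
  exact (measurable_observe N s).comp (((measurable_priorMean c σ r).comp h1).prodMk h2)

/-- The loss of the estimator `T` for task `k`, counted on the good set only. -/
def goodLoss {N : Fin B → ℕ} (c : Fin B → Fin J) (h σ : ℝ) (r : Fin J → ℝ)
    (T : Sample N d → Fin B → EuclideanSpace ℝ (Fin d)) (k : Fin B)
    (p : (Fin J ⊕ Fin B → EuclideanSpace ℝ (Fin d)) × Sample N d) : ℝ≥0∞ :=
  (goodSet B J d h).indicator (fun _ => (1 : ℝ≥0∞)) p.1 *
    ENNReal.ofReal (‖T p.2 k - priorMean c σ r p.1 k‖ ^ 2)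

lemma measurable_goodLoss {N : Fin B → ℕ} (c : Fin B → Fin J) (h σ : ℝ) (r : Fin J → ℝ)
    {T : Sample N d → Fin B → EuclideanSpace ℝ (Fin d)} (hT : Measurable T) (k : Fin B) :
    Measurable (goodLoss c h σ r T k) := by
  refine ((measurable_const.indicator (measurableSet_goodSet h)).comp measurable_fst).mul ?_
  have h2 : Measurable fun p : (Fin J ⊕ Fin B → EuclideanSpace ℝ (Fin d)) × Sample N d =>
      T p.2 k := (measurable_pi_apply k).comp (hT.comp measurable_snd)
  have h3 : Measurable fun p : (Fin J ⊕ Fin B → EuclideanSpace ℝ (Fin d)) × Sample N d =>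
      priorMean c σ r p.1 k :=
    (measurable_pi_apply k).comp ((measurable_priorMean c σ r).comp measurable_fst)
  exact (((h2.sub h3).norm).pow_const 2).ennreal_ofReal

/-- The average over the good set of the compound risk is at most its supremum. -/
lemma lintegral_goodLoss_le_iSup (N : Fin B → ℕ) (s : Fin B → ℝ)
    {C : Fin J → Finset (Fin B)} {c : Fin B → Fin J}
    (hc : ∀ k j, k ∈ C j ↔ c k = j) {ζ : Fin J → ℝ} (hζ : ∀ j, 0 ≤ ζ j) {h : ℝ} (h1 : h < 1)
    (σ : ℝ) {S : Matrix (Fin d) (Fin d) ℝ} (hS : S.PosSemidef)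
    {T : Sample N d → Fin B → EuclideanSpace ℝ (Fin d)} (hT : Measurable T)
    {r : Fin J → ℝ} (hr : r = fun j => (1 - h) * (ζ j / 2)) :
    (∑ k, (∫⁻ ω, goodLoss c h σ r T k ((fun a => ω (.inl a)),
        observe N s (priorMean c σ r fun a => ω (.inl a)) fun b => ω (.inr b))
        ∂(whiteNoise ((Fin J ⊕ Fin B) ⊕ (Σ k, Fin (N k))) S)) /
          ENNReal.ofReal (s k ^ 2)) / (B : ℝ≥0∞) ≤
      ⨆ μ ∈ meanClass d C ζ, compoundRisk N s S μ T := by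
  have hmF := measurable_goodLoss c h σ r hT
  have hm1 : Measurable fun ω : (Fin J ⊕ Fin B) ⊕ (Σ k, Fin (N k)) → EuclideanSpace ℝ (Fin d) =>
      (fun a => ω (.inl a) : Fin J ⊕ Fin B → EuclideanSpace ℝ (Fin d)) :=
    measurable_pi_lambda _ fun a => measurable_pi_apply _
  have hmS : Measurable fun p : (Fin J ⊕ Fin B → EuclideanSpace ℝ (Fin d)) × Sample N d =>
      (∑ k, goodLoss c h σ r T k p / ENNReal.ofReal (s k ^ 2)) / B :=
    (Finset.measurable_fun_sum _ fun k _ => (hmF k).div_const _).div_const _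
  rw [← lintegral_sum_div_div _ (f := fun k
      (ω : (Fin J ⊕ Fin B) ⊕ (Σ k, Fin (N k)) → EuclideanSpace ℝ (Fin d)) =>
      goodLoss c h σ r T k ((fun a => ω (.inl a)),
        observe N s (priorMean c σ r fun a => ω (.inl a)) fun b => ω (.inr b)))
    (fun k => (hmF k).comp (hm1.prodMk (measurable_observe_priorMean N s c σ r))),
    lintegral_whiteNoise_sum (κ := Fin J ⊕ Fin B) hS N s (measurable_priorMean c σ r)
    (F := fun p x => (∑ k, goodLoss c h σ r T k (p, x) / ENNReal.ofReal (s k ^ 2)) / B) hmS]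
  have hle : ∀ p, ∫⁻ x, (∑ k, goodLoss c h σ r T k (p, x) / ENNReal.ofReal (s k ^ 2)) / B
      ∂(jointLaw N s S (priorMean c σ r p)) ≤
      ⨆ μ ∈ meanClass d C ζ, compoundRisk N s S μ T := fun p => by
    by_cases hp : p ∈ goodSet B J d h
    · have hmem : priorMean c σ r p ∈ meanClass d C ζ := by
        rw [hr]; exact priorMean_mem_meanClass hc hζ h1 hp
      refine le_trans (le_of_eq ?_)
        (le_iSup₂ (f := fun μ _ => compoundRisk N s S μ T) (priorMean c σ r p) hmem)
      rw [compoundRisk_eq_lintegral S _ hT]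
      simp only [goodLoss, Set.indicator_of_mem hp, one_mul]
    · simp [goodLoss, Set.indicator_of_notMem hp]
  refine (lintegral_mono hle).trans ?_
  simp

/-- Non-asymptotic minimax lower bound for diagonal shape matrices. -/
lemma sum_bayesRisk_le_minimaxRisk {N : Fin B → ℕ} (hN : ∀ k, 0 < N k) {s : Fin B → ℝ}
    (hs : ∀ k, 0 < s k) {C : Fin J → Finset (Fin B)} {c : Fin B → Fin J}
    (hc : ∀ k j, k ∈ C j ↔ c k = j) {ζ : Fin J → ℝ} (hζ : ∀ j, 0 ≤ ζ j) {h : ℝ} (h0 : 0 < h)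
    (h1 : h < 1) {lam : Fin d → ℝ} {t : ℝ}
    (hlam : ∀ i, 0 ≤ lam i) (ht0 : 0 < t) (ht : ∀ i, lam i ≤ t⁻¹) (hsum : ∑ i, lam i = 1) :
    (∑ k, ENNReal.ofReal (bayesRisk s c h (fun j => (1 - h) * (ζ j / 2)) k)) / (B : ℝ≥0∞) ≤
      minimaxRisk N s C ζ (Matrix.diagonal lam) +
      (∑ k, ENNReal.ofReal ((3 + 36 * B / h ^ 2) * N k *
        (Var[fun x => x ^ 2; gaussianReal 0 1] / t))) / (B : ℝ≥0∞) := by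
  -- The error term does not depend on the estimator; moving it to the left leaves a bare infimum on
  -- the right.
  rw [← tsub_le_iff_right]
  refine le_iInf₂ fun T hT => ?_
  rw [tsub_le_iff_right]
  obtain ⟨r, hr⟩ : ∃ r : Fin J → ℝ, r = fun j => (1 - h) * (ζ j / 2) := ⟨_, rfl⟩
  rw [← hr]
  have hσ2 : h * √(1 / h) ^ 2 = 1 := by
    rw [Real.sq_sqrt (by positivity)]; field_simp
  have hS : (Matrix.diagonal lam).PosSemidef := Matrix.PosSemidef.diagonal hlam
  refine le_trans ?_ (add_le_add_left
    (lintegral_goodLoss_le_iSup N s hc hζ h1 √(1 / h) hS hT hr) _)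
  rw [← ENNReal.add_div, ← Finset.sum_add_distrib]
  gcongr with k
  have h2 := bayesRisk_le_lintegral_goodSet hN hs c h0 h1 hσ2 r hlam ht0 ht hsum
    ((measurable_pi_apply k).comp hT) k
  have hsk : 0 < s k ^ 2 := pow_pos (hs k) 2
  have h3 := ENNReal.div_le_div_right h2 (ENNReal.ofReal (s k ^ 2))
  rw [ENNReal.add_div, ← ENNReal.ofReal_div_of_pos hsk, ← ENNReal.ofReal_div_of_pos hsk,
    mul_div_cancel_right₀ _ hsk.ne'] at h3
  have h4 : (3 + 36 * B / h ^ 2) * (N k * s k ^ 2) *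
        (Var[fun x => x ^ 2; gaussianReal 0 1] / t) / s k ^ 2 =
      (3 + 36 * B / h ^ 2) * N k * (Var[fun x => x ^ 2; gaussianReal 0 1] / t) := by
    have := (hs k).ne'
    field_simp
  rw [h4] at h3
  exact h3

end Truncation

/-! ### Elementary properties of the oracle risk function. -/

section OracleRisk

/-- With `x = τ * (1 - ν)` this is `(ν + x) / (1 + x)`, a form in which `τ` enters only through `x`.
-/
lemma oracleRisk_eq {τ ν : ℝ} (hτ : 0 ≤ τ) (hν : ν ≤ 1) :
    oracleRisk τ ν = (ν + τ * (1 - ν)) / (1 + τ * (1 - ν)) := by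
  have h1 : 0 < 1 + τ := by linarith
  have h2 : 0 < 1 + τ * (1 - ν) := by nlinarith [mul_nonneg hτ (sub_nonneg.2 hν)]
  unfold oracleRisk
  field_simp
  ring

lemma oracleRisk_mono {τ τ' ν : ℝ} (hτ : 0 ≤ τ) (h : τ ≤ τ') (hν : ν ≤ 1) :
    oracleRisk τ ν ≤ oracleRisk τ' ν := by
  have hw := sub_nonneg.2 hν
  rw [oracleRisk_eq hτ hν, oracleRisk_eq (hτ.trans h) hν]
  have h1 := mul_nonneg hτ hw
  have h2 : τ * (1 - ν) ≤ τ' * (1 - ν) := mul_le_mul_of_nonneg_right h hw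
  rw [div_le_div_iff₀ (by linarith) (by linarith)]
  nlinarith

/-- With `x = τ * (1 - ν)`, the numerator satisfies `ν + x / 4 ≥ (ν + x) / 4`, while the denominator
only decreases. -/
lemma oracleRisk_div_four_le {τ ν : ℝ} (hτ : 0 ≤ τ) (h0 : 0 ≤ ν) (hν : ν ≤ 1) :
    oracleRisk τ ν / 4 ≤ oracleRisk (τ / 4) ν := by
  have hw := mul_nonneg hτ (sub_nonneg.2 hν)
  rw [oracleRisk_eq hτ hν, oracleRisk_eq (by positivity) hν, div_div,
    show τ / 4 * (1 - ν) = τ * (1 - ν) / 4 by ring]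
  rw [div_le_div_iff₀ (by linarith) (by linarith)]
  nlinarith [mul_nonneg h0 hw]

end OracleRisk

/-! ### Partitions, and the comparison of oracle and Bayes risks. -/

section Partition

variable {B J d : ℕ}

lemma IsPartition.exists_label {C : Fin J → Finset (Fin B)} (hC : IsPartition C) :
    ∃ c : Fin B → Fin J, ∀ k j, k ∈ C j ↔ c k = j := by
  choose c hc hu using hC
  exact ⟨c, fun k j => ⟨fun h => (hu k j h).symm, fun h => h ▸ hc k⟩⟩

lemma Lstar_eq_sum (s : Fin B → ℝ) {C : Fin J → Finset (Fin B)} {c : Fin B → Fin J}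
    (hc : ∀ k j, k ∈ C j ↔ c k = j) (ζ : Fin J → ℝ) :
    Lstar s C ζ = 1 / (B : ℝ) *
      ∑ k, oracleRisk (ζ (c k) ^ 2 / s k ^ 2) (aggVar s (C (c k)) / s k ^ 2) := by
  unfold Lstar
  congr 1
  have h : ∀ j, C j = Finset.univ.filter fun k => c k = j := fun j => by
    ext k; simp [hc]
  have h2 : ∀ j, ∑ k ∈ C j, oracleRisk (ζ j ^ 2 / s k ^ 2) (aggVar s (C j) / s k ^ 2) =
      ∑ k, if c k = j then oracleRisk (ζ j ^ 2 / s k ^ 2) (aggVar s (C j) / s k ^ 2) else 0 :=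
    fun j => by rw [← Finset.sum_filter, ← h j]
  simp_rw [h2]
  rw [Finset.sum_comm]
  simp

lemma aggVar_div_nonneg (s : Fin B → ℝ) (U : Finset (Fin B)) (k : Fin B) :
    0 ≤ aggVar s U / s k ^ 2 := by
  unfold aggVar; positivity

lemma inv_sq_le_sum {s : Fin B → ℝ} {U : Finset (Fin B)} {k : Fin B} (hk : k ∈ U) :
    1 / s k ^ 2 ≤ ∑ l ∈ U, 1 / s l ^ 2 :=
  Finset.single_le_sum (f := fun l => 1 / s l ^ 2) (fun l _ => by positivity) hk

lemma aggVar_div_le_one {s : Fin B → ℝ} (hs : ∀ k, 0 < s k) {U : Finset (Fin B)} {k : Fin B}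
    (hk : k ∈ U) : aggVar s U / s k ^ 2 ≤ 1 := by
  have hsk : 0 < s k ^ 2 := pow_pos (hs k) 2
  rw [div_le_one hsk, aggVar]
  refine inv_le_of_inv_le₀ hsk ?_
  rw [← one_div]
  exact inv_sq_le_sum hk

lemma Lstar_div_four_le {s : Fin B → ℝ} (hs : ∀ k, 0 < s k) {C : Fin J → Finset (Fin B)}
    {c : Fin B → Fin J} (hc : ∀ k j, k ∈ C j ↔ c k = j) (ζ : Fin J → ℝ) :
    Lstar s C ζ / 4 ≤ Lstar s C (fun j => ζ j / 2) := by
  rw [Lstar_eq_sum s hc, Lstar_eq_sum s hc, mul_div_assoc, Finset.sum_div]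
  gcongr with k
  rw [show (ζ (c k) / 2) ^ 2 / s k ^ 2 = ζ (c k) ^ 2 / s k ^ 2 / 4 by ring]
  exact oracleRisk_div_four_le (by positivity) (aggVar_div_nonneg s _ k)
    (aggVar_div_le_one hs ((hc k _).2 rfl))

/-- The oracle bound is dominated by the Bayes risk with a flat prior on the group centres. -/
lemma oracleRisk_le_bayesRisk {s : Fin B → ℝ} (hs : ∀ k, 0 < s k) {C : Fin J → Finset (Fin B)}
    {c : Fin B → Fin J} (hc : ∀ k j, k ∈ C j ↔ c k = j) (r : Fin J → ℝ) (k : Fin B) :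
    oracleRisk (r (c k) ^ 2 / s k ^ 2) (aggVar s (C (c k)) / s k ^ 2) ≤ bayesRisk s c 0 r k := by
  have hk : k ∈ C (c k) := (hc k _).2 rfl
  have hW := groupWeight_pos hs c r k
  -- Dropping `r ^ 2` from the weight of every task of the group except `k` can only increase the
  -- total weight.
  have hWS : groupWeight s c r (c k) ≤ 1 / (r (c k) ^ 2 + s k ^ 2) +
      (∑ l ∈ C (c k), 1 / s l ^ 2 - 1 / s k ^ 2) := by
    have h1 : groupWeight s c r (c k) = ∑ l ∈ C (c k), 1 / (r (c k) ^ 2 + s l ^ 2) := by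
      have h : C (c k) = Finset.univ.filter fun l => c l = c k := by ext l; simp [hc]
      rw [h, Finset.sum_filter]; rfl
    have h2 := Finset.single_le_sum
      (f := fun l => 1 / s l ^ 2 - 1 / (r (c k) ^ 2 + s l ^ 2)) (fun l _ => ?_) hk
    · rw [Finset.sum_sub_distrib, ← h1] at h2
      linarith
    · have := pow_pos (hs l) 2
      exact sub_nonneg.2 (one_div_le_one_div_of_le this (by nlinarith [sq_nonneg (r (c k))]))
  have hS := inv_sq_le_sum (s := s) hk
  have hsk : 0 < s k ^ 2 := pow_pos (hs k) 2
  unfold bayesRisk sharedCov aggVar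
  rw [zero_add]
  set S := ∑ l ∈ C (c k), 1 / s l ^ 2
  set W := groupWeight s c r (c k)
  set q := s k ^ 2
  set ρ := r (c k) ^ 2 with hρ
  have hρ0 : 0 ≤ ρ := sq_nonneg _
  have hrq : 0 < ρ + q := by linarith
  have hS0 : 0 < S := lt_of_lt_of_le (by positivity) hS
  set W' := 1 / (ρ + q) + (S - 1 / q) with hW'
  have hW'0 : 0 < W' := lt_of_lt_of_le hW hWS
  -- The oracle risk is exactly the Bayes formula at `h = 0` with `W` replaced by the larger `W'`,
  -- and that formula decreases in the weight.
  have hor : oracleRisk (ρ / q) (S⁻¹ / q) = (q / (ρ + q) / W' + ρ) / (ρ + q) := by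
    have hkey : 1 + ρ / q * (1 - S⁻¹ / q) = (ρ + q) * W' * (S⁻¹ / q) := by
      rw [hW']; field_simp; ring
    unfold oracleRisk
    rw [hkey]
    have h1 : 1 + ρ / q = (ρ + q) / q := by field_simp; ring
    rw [h1]
    field_simp
    ring
  rw [hor]
  gcongr

end Partition

/-! ### Shape matrices of every real effective dimension `t > 1`. -/

section Shape

/-- Eigenvalues of a shape matrix of effective dimension `t`. -/
def shapeEigenvalues (t : ℝ) : Fin (⌊t⌋₊ + 1) → ℝ :=
  Fin.cons t⁻¹ fun _ => (1 - t⁻¹) / ⌊t⌋₊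

variable {t : ℝ}

lemma shapeEigenvalues_pos (ht : 1 < t) (i : Fin (⌊t⌋₊ + 1)) : 0 < shapeEigenvalues t i := by
  have h0 : 0 < t := by linarith
  have h1 : t⁻¹ < 1 := inv_lt_one_of_one_lt₀ ht
  have h2 : 0 < (⌊t⌋₊ : ℝ) := by exact_mod_cast Nat.floor_pos.2 ht.le
  refine Fin.cases ?_ (fun i => ?_) i
  · simpa [shapeEigenvalues] using h0
  · simpa [shapeEigenvalues] using div_pos (sub_pos.2 h1) h2

/-- The mass `1 - t⁻¹` is shared by `⌊t⌋₊` eigenvalues, and `t - 1 ≤ ⌊t⌋₊` keeps each below `t⁻¹`,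
which is thus the operator norm even for non-integer `t`. -/
lemma shapeEigenvalues_le (ht : 1 < t) (i : Fin (⌊t⌋₊ + 1)) : shapeEigenvalues t i ≤ t⁻¹ := by
  have h0 : 0 < t := by linarith
  have h2 : 0 < (⌊t⌋₊ : ℝ) := by exact_mod_cast Nat.floor_pos.2 ht.le
  have h3 := Nat.lt_floor_add_one t
  refine Fin.cases ?_ (fun i => ?_) i
  · simp [shapeEigenvalues]
  · simp only [shapeEigenvalues, Fin.cons_succ]
    rw [div_le_iff₀ h2]
    field_simp
    linarith

lemma sum_shapeEigenvalues (ht : 1 < t) : ∑ i, shapeEigenvalues t i = 1 := by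
  have h2 : 0 < (⌊t⌋₊ : ℝ) := by exact_mod_cast Nat.floor_pos.2 ht.le
  rw [Fin.sum_univ_succ]
  simp only [shapeEigenvalues, Fin.cons_zero, Fin.cons_succ, Finset.sum_const, Finset.card_univ,
    Fintype.card_fin, nsmul_eq_mul]
  field_simp
  ring

open scoped Matrix.Norms.L2Operator in
lemma norm_toEuclideanCLM_diagonal {d : ℕ} (v : Fin d → ℝ) :
    ‖Matrix.toEuclideanCLM (𝕜 := ℝ) (Matrix.diagonal v)‖ = ‖v‖ := by
  rw [← Matrix.cstar_norm_def, Matrix.l2_opNorm_diagonal]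

lemma diagonal_mem_shapeMatrices (ht : 1 < t) :
    Matrix.diagonal (shapeEigenvalues t) ∈ shapeMatrices (⌊t⌋₊ + 1) t := by
  have h0 : 0 < t := by linarith
  have hn : ‖shapeEigenvalues t‖ = t⁻¹ := by
    refine le_antisymm ((pi_norm_le_iff_of_nonneg (by positivity)).2 fun i => ?_) ?_
    · rw [Real.norm_eq_abs, abs_of_pos (shapeEigenvalues_pos ht i)]
      exact shapeEigenvalues_le ht i
    · have := norm_le_pi_norm (shapeEigenvalues t) 0
      rw [Real.norm_eq_abs, abs_of_pos (shapeEigenvalues_pos ht 0)] at this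
      simpa [shapeEigenvalues] using this
  have htr : (Matrix.diagonal (shapeEigenvalues t)).trace = 1 := by
    rw [Matrix.trace_diagonal, sum_shapeEigenvalues ht]
  refine ⟨Matrix.PosDef.diagonal (shapeEigenvalues_pos ht), htr, ?_⟩
  rw [effDim, htr, norm_toEuclideanCLM_diagonal, hn, one_div, inv_inv]

lemma effDim_smul {d : ℕ} {a : ℝ} (ha : 0 < a) (S : Matrix (Fin d) (Fin d) ℝ) :
    effDim (a • S) = effDim S := by
  unfold effDim
  rw [Matrix.trace_smul, map_smul, norm_smul, Real.norm_eq_abs, abs_of_pos ha, smul_eq_mul,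
    mul_div_mul_left _ _ ha.ne']

end Shape

/-! ### The limits in `t` and `h`. -/

section LowerBound

variable {B J : ℕ}

lemma bayesRisk_nonneg {s : Fin B → ℝ} (hs : ∀ k, 0 < s k) (c : Fin B → Fin J) {h : ℝ}
    (h0 : 0 ≤ h) (r : Fin J → ℝ) (k : Fin B) : 0 ≤ bayesRisk s c h r k := by
  have := groupWeight_pos hs c r k
  unfold bayesRisk sharedCov
  positivity

/-- At `h = 0` the prior on the centres is improper, but the formula stays regular because the group
weight is positive. -/
lemma continuousAt_bayesRisk {s : Fin B → ℝ} (hs : ∀ k, 0 < s k) (c : Fin B → Fin J) (ζ : Fin J → ℝ)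
    (k : Fin B) :
    ContinuousAt (fun h => bayesRisk s c h (fun j => (1 - h) * (ζ j / 2)) k) 0 := by
  have hpos : ∀ x l, x ^ 2 + s l ^ 2 ≠ 0 := fun x l => by have := hs l; positivity
  have hq : ∀ j l, ContinuousAt (fun h : ℝ => ((1 - h) * (ζ j / 2)) ^ 2 + s l ^ 2) 0 :=
    fun j l => by fun_prop
  have hW : ∀ j, ContinuousAt
      (fun h : ℝ => groupWeight s c (fun j => (1 - h) * (ζ j / 2)) j) 0 := fun j => by
    unfold groupWeight
    refine tendsto_finsetSum _ fun l _ => ?_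
    split_ifs
    · exact (continuousAt_const.div (hq j l) (hpos _ l))
    · exact tendsto_const_nhds
  unfold bayesRisk sharedCov
  refine ((((continuousAt_const.div (hq _ k) (hpos _ k)).div (continuousAt_id.add (hW _)) ?_)).add
    ?_).div (hq _ k) (hpos _ k)
  · have := groupWeight_pos hs c (fun j => (1 - (0 : ℝ)) * (ζ j / 2)) k
    simpa using this.ne'
  · fun_prop

/-- The error is of order `1 / (h ^ 2 * t)`, so `h` is kept fixed while `t` tends to infinity. -/
lemma ofReal_bayesRisk_le_liminf (hB : 0 < B) {N : Fin B → ℕ} (hN : ∀ k, 0 < N k) {s : Fin B → ℝ}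
    (hs : ∀ k, 0 < s k) {C : Fin J → Finset (Fin B)} {c : Fin B → Fin J}
    (hc : ∀ k j, k ∈ C j ↔ c k = j) {ζ : Fin J → ℝ} (hζ : ∀ j, 0 ≤ ζ j) {h : ℝ} (h0 : 0 < h)
    (h1 : h < 1) :
    ENNReal.ofReal (1 / (B : ℝ) * ∑ k, bayesRisk s c h (fun j => (1 - h) * (ζ j / 2)) k) ≤
      liminf (worstMinimaxRisk N s C ζ) atTop := by
  have hB0 : (0 : ℝ) < B := by exact_mod_cast hB
  have hX : ENNReal.ofReal (1 / (B : ℝ) *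
      ∑ k, bayesRisk s c h (fun j => (1 - h) * (ζ j / 2)) k) ≤
      (∑ k, ENNReal.ofReal (bayesRisk s c h (fun j => (1 - h) * (ζ j / 2)) k)) / (B : ℝ≥0∞) := by
    rw [one_div, inv_mul_eq_div, ENNReal.ofReal_div_of_pos hB0, ENNReal.ofReal_natCast]
    rw [ENNReal.ofReal_sum_of_nonneg fun k _ => bayesRisk_nonneg hs c h0.le _ k]
  refine hX.trans (ENNReal.le_of_forall_pos_le_add fun ε hε _ => ?_)
  rw [← tsub_le_iff_right]
  refine le_liminf_of_le (by isBoundedDefault) ?_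
  have herr : Tendsto (fun t : ℝ => (∑ k, ENNReal.ofReal ((3 + 36 * B / h ^ 2) * N k *
        (Var[fun x => x ^ 2; gaussianReal 0 1] / t))) / (B : ℝ≥0∞)) atTop (nhds 0) := by
    have h3 : ∀ k, Tendsto (fun t : ℝ => ENNReal.ofReal ((3 + 36 * B / h ^ 2) * N k *
        (Var[fun x => x ^ 2; gaussianReal 0 1] / t))) atTop (nhds 0) := fun k => by
      have h4 := (tendsto_const_nhds (x := Var[fun x => x ^ 2; gaussianReal 0 1])).div_atTop
        (tendsto_id (α := ℝ) (x := atTop))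
      simpa using ENNReal.tendsto_ofReal (h4.const_mul ((3 + 36 * B / h ^ 2) * (N k : ℝ)))
    have h5 := tendsto_finsetSum Finset.univ fun k _ => h3 k
    have h6 := ENNReal.Tendsto.div_const h5 (b := (B : ℝ≥0∞)) (Or.inr (by positivity))
    simpa using h6
  filter_upwards [eventually_gt_atTop 1,
    herr.eventually_le_const (u := (ε : ℝ≥0∞)) (by exact_mod_cast hε)] with t ht het
  have h0t : 0 < t := by linarith
  rw [tsub_le_iff_right]
  refine (sum_bayesRisk_le_minimaxRisk hN hs hc hζ h0 h1
    (fun i => (shapeEigenvalues_pos ht i).le) h0t (shapeEigenvalues_le ht)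
    (sum_shapeEigenvalues ht)).trans ?_
  gcongr
  exact le_iSup₂_of_le (f := fun d S => ⨆ (_ : S ∈ shapeMatrices d t), minimaxRisk N s C ζ S)
    (⌊t⌋₊ + 1) (Matrix.diagonal (shapeEigenvalues t))
    (le_iSup_of_le (diagonal_mem_shapeMatrices ht) le_rfl)

/-- Compound minimax lower bound. -/
lemma ofReal_Lstar_le_liminf (hB : 0 < B) {N : Fin B → ℕ} (hN : ∀ k, 0 < N k) {s : Fin B → ℝ}
    (hs : ∀ k, 0 < s k) {C : Fin J → Finset (Fin B)} {c : Fin B → Fin J}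
    (hc : ∀ k j, k ∈ C j ↔ c k = j) {ζ : Fin J → ℝ} (hζ : ∀ j, 0 ≤ ζ j) :
    ENNReal.ofReal (Lstar s C fun j => ζ j / 2) ≤ liminf (worstMinimaxRisk N s C ζ) atTop := by
  have hlim : Tendsto (fun h => ENNReal.ofReal (1 / (B : ℝ) *
      ∑ k, bayesRisk s c h (fun j => (1 - h) * (ζ j / 2)) k)) (nhdsWithin 0 (Set.Ioi 0))
      (nhds (ENNReal.ofReal (1 / (B : ℝ) *
        ∑ k, bayesRisk s c 0 (fun j => (1 - 0) * (ζ j / 2)) k))) :=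
    ENNReal.tendsto_ofReal (((tendsto_finsetSum _ fun k _ =>
      continuousAt_bayesRisk hs c ζ k).const_mul _).mono_left nhdsWithin_le_nhds)
  refine le_trans ?_ (le_of_tendsto hlim ?_)
  · refine ENNReal.ofReal_le_ofReal ?_
    rw [Lstar_eq_sum s hc]
    simp only [sub_zero, one_mul]
    gcongr with k
    exact oracleRisk_le_bayesRisk hs hc (fun j => ζ j / 2) k
  · filter_upwards [Ioo_mem_nhdsGT (zero_lt_one (α := ℝ))] with h hh
    exact ofReal_bayesRisk_le_liminf hB hN hs hc hζ hh.1 hh.2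

end LowerBound

/-! ### The `Q`-aggregation bound in the limit. -/

section UpperBound

variable {B J d : ℕ}

/-- The oracle bound only depends on the groups, not on their labels. -/
lemma exists_relabelled_partition (s : Fin B → ℝ) (hs : ∀ k, 0 < s k)
    {C : Fin J → Finset (Fin B)} {c : Fin B → Fin J} (hc : ∀ k j, k ∈ C j ↔ c k = j)
    {ζ : Fin J → ℝ} {μ : Fin B → EuclideanSpace ℝ (Fin d)} (hμ : μ ∈ meanClass d C ζ) :
    ∃ P : {C : Fin B → Finset (Fin B) // IsPartition C},
      Lstar s P.1 (groupDiam P.1 μ) ≤ Lstar s C ζ := by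
  classical
  -- Each group is labelled by its smallest member, so that labels lie in `Fin B` whatever `J` is;
  -- other labels carry empty groups.
  obtain ⟨g, hg⟩ : ∃ g : Fin B → Fin B, ∀ k l, g k = g l ↔ c k = c l := by
    refine ⟨fun k => (Finset.univ.filter fun l => c l = c k).min' ⟨k, by simp⟩, fun k l =>
      ⟨fun h => ?_, fun h => by simp only [h]⟩⟩
    have h1 := Finset.min'_mem (Finset.univ.filter fun m => c m = c k) ⟨k, by simp⟩
    have h2 := Finset.min'_mem (Finset.univ.filter fun m => c m = c l) ⟨l, by simp⟩
    simp only at h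
    rw [h] at h1
    simp only [Finset.mem_filter] at h1 h2
    exact h1.2.symm.trans h2.2
  set C' : Fin B → Finset (Fin B) := fun b => Finset.univ.filter fun k => g k = b with hC'
  have hc' : ∀ k b, k ∈ C' b ↔ g k = b := fun k b => by simp [hC']
  have hCC : ∀ k, C' (g k) = C (c k) := fun k => by
    ext l; rw [hc', hc, hg]
  refine ⟨⟨C', fun k => ⟨g k, (hc' k _).2 rfl, fun b hb => ((hc' k b).1 hb).symm⟩⟩, ?_⟩
  rw [Lstar_eq_sum s hc', Lstar_eq_sum s hc]
  gcongr with k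
  rw [hCC]
  refine oracleRisk_mono (by positivity) ?_ (aggVar_div_le_one hs ((hc k _).2 rfl))
  have h1 : groupDiam C' μ (g k) = groupDiam C μ (c k) := by
    unfold groupDiam; rw [hCC]
  have h2 : 0 ≤ groupDiam C μ (c k) := Metric.diam_nonneg
  rw [h1]
  gcongr
  exact hμ (c k)

/-- Effective dimension is scale invariant, so all tasks share the value `t`; the relabelled
partition of the model is then a competitor in the minimum. -/
lemma qAggBound_le (hB : 0 < B) {N : Fin B → ℕ} (hN : ∀ k, 0 < N k) {s : Fin B → ℝ}
    (hs : ∀ k, 0 < s k) {C : Fin J → Finset (Fin B)} {c : Fin B → Fin J}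
    (hc : ∀ k j, k ∈ C j ↔ c k = j) {ζ : Fin J → ℝ}
    {b u t : ℝ} (hb : 0 ≤ b) {S : Matrix (Fin d) (Fin d) ℝ} (hS : S ∈ shapeMatrices d t)
    {μ : Fin B → EuclideanSpace ℝ (Fin d)} (hμ : μ ∈ meanClass d C ζ) :
    qAggBound b u N s S μ ≤
      (1 + b * B * Real.exp (-u / 2)) * (Lstar s C ζ + b * u / √t) := by
  have : Nonempty (Fin B) := ⟨⟨0, hB⟩⟩
  have hdim : ∀ k, √(effDim (taskCov N s S k)) = √t := fun k => by
    have h1 := pow_pos (hs k) 2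
    have h2 : (0 : ℝ) < N k := by exact_mod_cast hN k
    rw [taskCov, effDim_smul (by positivity), hS.2.2]
  unfold qAggBound
  simp_rw [hdim]
  rw [ciInf_const]
  gcongr
  obtain ⟨P, hP⟩ := exists_relabelled_partition s hs hc hμ
  exact (ciInf_le (Set.finite_range _).bddBelow P).trans (by gcongr)

lemma limsup_worstQAggBound_le (hB : 0 < B) {N : Fin B → ℕ} (hN : ∀ k, 0 < N k) {s : Fin B → ℝ}
    (hs : ∀ k, 0 < s k) {C : Fin J → Finset (Fin B)} {c : Fin B → Fin J}
    (hc : ∀ k j, k ∈ C j ↔ c k = j) (ζ : Fin J → ℝ) {b : ℝ} (hb : 0 ≤ b) (u : ℝ) :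
    limsup (worstQAggBound b u N s C ζ) atTop ≤
      ENNReal.ofReal ((1 + b * B * Real.exp (-u / 2)) * Lstar s C ζ) := by
  have hlim : Tendsto (fun t : ℝ => ENNReal.ofReal
      ((1 + b * B * Real.exp (-u / 2)) * (Lstar s C ζ + b * u / √t))) atTop
      (nhds (ENNReal.ofReal ((1 + b * B * Real.exp (-u / 2)) * Lstar s C ζ))) := by
    have h1 : Tendsto (fun t : ℝ => b * u / √t) atTop (nhds 0) :=
      tendsto_const_nhds.div_atTop Real.tendsto_sqrt_atTop
    have h2 := ((h1.const_add (Lstar s C ζ)).const_mul (1 + b * B * Real.exp (-u / 2)))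
    rw [add_zero] at h2
    exact ENNReal.tendsto_ofReal h2
  rw [← hlim.limsup_eq]
  refine limsup_le_limsup (.of_forall fun t => ?_)
  refine iSup₂_le fun d S => iSup₂_le fun hS μ => iSup_le fun hμ => ?_
  exact ENNReal.ofReal_le_ofReal (qAggBound_le hB hN hs hc hb hS hμ)

end UpperBound

end

end CompoundMinimax

theorem mainTheorem7 {B J : ℕ} (hB : 0 < B) (N : Fin B → ℕ) (hN : ∀ k, 0 < N k)
    (s : Fin B → ℝ) (hs : ∀ k, 0 < s k)
    (C : Fin J → Finset (Fin B)) (hC : CompoundMinimax.IsPartition C)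
    (ζ : Fin J → ℝ) (hζ : ∀ j, 0 ≤ ζ j) :
    ENNReal.ofReal (CompoundMinimax.Lstar s C (fun j => ζ j / 2)) ≤
        liminf (CompoundMinimax.worstMinimaxRisk N s C ζ) atTop ∧
      CompoundMinimax.Lstar s C ζ / 4 ≤ CompoundMinimax.Lstar s C (fun j => ζ j / 2) ∧
      ∀ c u : ℝ, 0 ≤ c → Real.log (17 * B) ≤ u →
        limsup (CompoundMinimax.worstQAggBound c u N s C ζ) atTop ≤
            ENNReal.ofReal (4 * (1 + c * B * Real.exp (-u / 2))) *
              liminf (CompoundMinimax.worstMinimaxRisk N s C ζ) atTop ∧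
        (2 * Real.log (17 * B) ≤ u →
          limsup (CompoundMinimax.worstQAggBound c u N s C ζ) atTop ≤
            ENNReal.ofReal (4 * (1 + c / 17)) *
              liminf (CompoundMinimax.worstMinimaxRisk N s C ζ) atTop) := by
  obtain ⟨lab, hlab⟩ := hC.exists_label
  have hlow := CompoundMinimax.ofReal_Lstar_le_liminf hB hN hs hlab hζ
  have hfour := CompoundMinimax.Lstar_div_four_le hs hlab ζ
  have hB0 : (0 : ℝ) < B := by exact_mod_cast hB
  refine ⟨hlow, hfour, fun c u hc _ => ?_⟩
  have hbound : limsup (CompoundMinimax.worstQAggBound c u N s C ζ) atTop ≤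
      ENNReal.ofReal (4 * (1 + c * B * Real.exp (-u / 2))) *
        liminf (CompoundMinimax.worstMinimaxRisk N s C ζ) atTop := by
    refine (CompoundMinimax.limsup_worstQAggBound_le hB hN hs hlab ζ hc u).trans ?_
    refine le_trans ?_ (mul_le_mul_right hlow _)
    rw [← ENNReal.ofReal_mul (by positivity)]
    refine ENNReal.ofReal_le_ofReal ?_
    have : 0 ≤ 1 + c * B * Real.exp (-u / 2) := by positivity
    nlinarith
  refine ⟨hbound, fun hu => hbound.trans ?_⟩
  gcongr
  -- The condition `u ≥ 2 log (17 B)` is what cancels the factor `B` in `c * B * exp (-u / 2)`.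
  have hexp : Real.exp (-u / 2) ≤ (17 * (B : ℝ))⁻¹ := by
    rw [← Real.exp_log (x := 17 * (B : ℝ)) (by positivity), ← Real.exp_neg]
    exact Real.exp_le_exp.2 (by linarith)
  calc c * B * Real.exp (-u / 2) ≤ c * B * (17 * (B : ℝ))⁻¹ := by gcongr
    _ = c / 17 := by field_simp
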